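/- Let $n\in\mathbb N$, $T>0$, $H_0,H_1\in\mathfrak{su}(n)$ (traceless skew-Hermitian matrices), and let $\rho_0,\theta$ be Hermitian $n\times n$ matrices. Let $\mathcal H=L^2([0,T],\mathbb R)$ with its standard inner product $(\cdot,\cdot)_{\mathcal H}$, and for $u\in\mathcal H$ let $\mathrm{End}_{\rho_0}(u)=\rho(T)$, where $\rho$ is the (Carathéodory) solution of $$\dot\rho(t)=[H_0+u(t)H_1,\rho(t)]\ \ (t\in[0,T]),\qquad \rho(0)=\rho_0 .$$ Let $\mathcal O(\rho_0)=\{U\rho_0U^\dagger : U\in SU(n)\}$, with tangent spaces $T_\rho\mathcal O(\rho_0)=\{[\rho,\Omega]:\Omega\in\mathfrak{su}(n)\}$ and the Riemannian metric $$\langle[\rho,\Omega_1],[\rho,\Omega_2]\rangle_\rho=\mathrm{tr}\big((\Omega_1^{\mathfrak p_\rho})^\dagger\,\Omega_2^{\mathfrak p_\rho}\big),$$ where $\Omega^{\mathfrak p_\rho}$ is the component of $\Omega$ in the orthogonal complement $\mathfrak p_\rho$ of $\{\Omega\in\mathfrak{su}(n):[\rho,\Omega]=0\}$ in $\mathfrak{su}(n)$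 for the Hilbert--Schmidt product. Put $J(\rho)=\mathrm{Re}\,\mathrm{tr}(\rho\theta)$ on $\mathcal O(\rho_0)$ and $\mathcal J=J\circ\mathrm{End}_{\rho_0}$ on $\mathcal H$. Let $d\mathrm{End}_{\rho_0}(u):\mathcal H\to T_{\mathrm{End}_{\rho_0}(u)}\mathcal O(\rho_0)$ be the differential of $\mathrm{End}_{\rho_0}$ at $u$, and let $d\mathrm{End}^*_{\rho_0}(u)$ be its adjoint with respect to $(\cdot,\cdot)_{\mathcal H}$ and $\langle\cdot,\cdot\rangle_{\mathrm{End}_{\rho_0}(u)}$, with image $\mathcal I_u\subset\mathcal H$. Assume: (H1) $\rho_0$ and $\theta$ both have simple eigenvalues; (H2) every $u\in\mathcal H$ is regular, i.e. $\mathrm{rank}\,d\mathrm{End}_{\rho_0}(u)=\dim\mathcal O(\rho_0)$. Then $J$ has exactly $M:=n!$ critical points on $\mathcal O(\rho_0)$. Moreover, let $\rho_1,\dots,\rho_M$ be any enumeration of them such that $J(\rho_1)\le\dots\le J(\rho_M)$, let $\mathcal H_i=\{u\in\mathcal H:\mathrm{End}_{\rho_0}(u)=\rho_i\}$, and for $u\in\mathcal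 H_i$ let $$\mathcal A(u)=d\mathrm{End}^*_{\rho_0}(u)\,\nabla^2J(\rho_i)\,d\mathrm{End}_{\rho_0}(u),$$ where $\nabla^2J(\rho_i)$ is the Riemannian Hessian of $J$ at $\rho_i$. Then $\mathcal J$ is of class $C^2$ and $\mathcal A(u)$ is its Hessian at $u$, that is, $D^2\mathcal J(u)(v,w)=(\mathcal A(u)v,w)_{\mathcal H}$ for all $v,w\in\mathcal H$; and (i) for $u\in\mathcal H_1$, $\mathcal A(u)$ restricted to $\mathcal I_u$ is positive definite: $(v,\mathcal A(u)v)_{\mathcal H}>0$ for all $0\ne v\in\mathcal I_u$; (ii) for $u\in\mathcal H_M$, $\mathcal A(u)$ restricted to $\mathcal I_u$ is negative definite: $(v,\mathcal A(u)v)_{\mathcal H}<0$ for all $0\ne v\in\mathcal I_u$; (iii) for $u\in\mathcal H_i$ with $1<i<M$, $\mathcal A(u)$ restricted to $\mathcal I_u$ is indefinite: $(v,\mathcal A(u)v)_{\mathcal H}$ takes both positive and negative values on $\mathcal I_u$. -/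

import Mathlib

open MeasureTheory
open scoped Matrix Matrix.Norms.L2Operator

noncomputable section

namespace QControl

/-- Complex `n × n` matrices. The operator norm is used only to speak of integrals and derivatives
of matrix-valued maps. -/
abbrev Mat (n : ℕ) : Type := Matrix (Fin n) (Fin n) ℂ

/-- The control space `L²([0,T], ℝ)`. -/
abbrev Control (T : ℝ) : Type := Lp ℝ 2 (volume.restrict (Set.Icc (0 : ℝ) T))

/-- Traceless skew-Hermitian matrices, as a real vector space. -/
def su (n : ℕ) : Submodule ℝ (Mat n) where
  carrier := {Ω | Ωᴴ = -Ω ∧ Ω.trace = 0}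
  zero_mem' := by simp
  add_mem' := by
    rintro a b ⟨ha, ha'⟩ ⟨hb, hb'⟩
    exact ⟨by rw [Matrix.conjTranspose_add, ha, hb, neg_add], by
      rw [Matrix.trace_add, ha', hb', add_zero]⟩
  smul_mem' := by
    rintro c a ⟨ha, ha'⟩
    exact ⟨by rw [Matrix.conjTranspose_smul, ha, star_trivial, smul_neg], by
      rw [Matrix.trace_smul, ha', smul_zero]⟩

variable {n : ℕ} {T : ℝ}

/-! ### Geometry of the unitary orbit -/

/-- The unitary orbit of `ρ₀`. -/
def orbit (ρ₀ : Mat n) : Set (Mat n) :=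
  {ρ | ∃ U ∈ Matrix.specialUnitaryGroup (Fin n) ℂ, ρ = U * ρ₀ * Uᴴ}

/-- Tangent space of the orbit at `ρ`: the image of `su n` under `Ω ↦ ρ * Ω - Ω * ρ`. -/
def tangentSpace (ρ : Mat n) : Submodule ℝ (Mat n) :=
  (su n).map (LinearMap.mulLeft ℝ ρ - LinearMap.mulRight ℝ ρ)

/-- The orthogonal complement in `su n`, for the Hilbert-Schmidt product, of the stabilizer algebra
of `ρ`. At `ρ = U * ρ₀ * Uᴴ` it is the conjugate by `U` of the complement at `ρ₀`. -/
def horizontal (ρ : Mat n) : Set (Mat n) :=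
  {Ω₁ | Ω₁ ∈ su n ∧ ∀ Ω₂ ∈ su n, ⁅ρ, Ω₂⁆ = 0 → (Ω₁ᴴ * Ω₂).trace = 0}

/-- For `ξ` tangent at `ρ`, the unique horizontal `Ω` such that `⁅ρ, Ω⁆ = ξ`. -/
def lift (ρ ξ : Mat n) : Mat n :=
  Classical.epsilon fun Ω => Ω ∈ horizontal ρ ∧ ⁅ρ, Ω⁆ = ξ

/-- The invariant Riemannian metric of the orbit. The trace is real for tangent `ξ`, `η`. -/
def metric (ρ ξ η : Mat n) : ℝ := ((lift ρ ξ)ᴴ * lift ρ η).trace.re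

/-- The objective on density matrices. -/
def objective (θ ρ : Mat n) : ℝ := (ρ * θ).trace.re

/-- Critical points of the objective on the orbit: the differential vanishes on the tangent
space. -/
def criticalPoints (ρ₀ θ : Mat n) : Set (Mat n) :=
  {ρ | ρ ∈ orbit ρ₀ ∧ ∀ ξ ∈ tangentSpace ρ, fderiv ℝ (objective θ) ρ ξ = 0}

/-- The Riemannian Hessian of the objective on the orbit, as a quadratic form: the second derivative
along the geodesic `t ↦ exp (-tΩ) * ρ * exp (tΩ)`, `Ω` horizontal, with initial velocity `ξ`. -/
def hessQuad (θ ρ ξ : Mat n) : ℝ :=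
  iteratedDeriv 2 (fun t : ℝ => objective θ
    (NormedSpace.exp (-t • lift ρ ξ) * ρ * NormedSpace.exp (t • lift ρ ξ))) 0

/-- The Riemannian Hessian as a symmetric bilinear form, by polarization. -/
def hessForm (θ ρ ξ η : Mat n) : ℝ :=
  (hessQuad θ ρ (ξ + η) - hessQuad θ ρ ξ - hessQuad θ ρ η) / 2

/-- The Riemannian Hessian as an operator on the tangent space: the unique tangent vector that
represents `hessForm θ ρ ξ` in the metric. -/
def hessOp (θ ρ ξ : Mat n) : Mat n :=
  Classical.epsilon fun ζ => ζ ∈ tangentSpace ρ ∧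
    ∀ η ∈ tangentSpace ρ, metric ρ ζ η = hessForm θ ρ ξ η

/-! ### The control system -/

/-- `ρ` solves on `[0,T]` the controlled Liouville-von Neumann equation with initial value `ρ₀`,
in the Caratheodory sense. -/
def IsTrajectory (H₀ H₁ ρ₀ : Mat n) (u : Control T) (ρ : ℝ → Mat n) : Prop :=
  ContinuousOn ρ (Set.Icc 0 T) ∧
    ∀ t ∈ Set.Icc 0 T, ρ t = ρ₀ + ∫ s in (0 : ℝ)..t, ⁅H₀ + u s • H₁, ρ s⁆

/-- The end-point map: the value at time `T` of the trajectory of `u`. -/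
def endMap (H₀ H₁ ρ₀ : Mat n) (u : Control T) : Mat n :=
  Classical.epsilon (IsTrajectory H₀ H₁ ρ₀ u) T

/-- The differential of the end-point map. -/
def dEnd (H₀ H₁ ρ₀ : Mat n) (u : Control T) : Control T →L[ℝ] Mat n :=
  fderiv ℝ (endMap H₀ H₁ ρ₀) u

/-- The adjoint of the differential of the end-point map, for the Riemannian metric at the end
point and the `L²` inner product. -/
def dEndAdj (H₀ H₁ ρ₀ : Mat n) (u : Control T) (ζ : Mat n) : Control T :=
  Classical.epsilon fun w =>
    ∀ v : Control T, metric (endMap H₀ H₁ ρ₀ u) ζ (dEnd H₀ H₁ ρ₀ u v) = inner ℝ w v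

/-- The image of the adjoint, which is defined on the tangent space at the end point. -/
def adjImage (H₀ H₁ ρ₀ : Mat n) (u : Control T) : Set (Control T) :=
  dEndAdj H₀ H₁ ρ₀ u '' (tangentSpace (endMap H₀ H₁ ρ₀ u) : Set (Mat n))

/-- A control is regular if the rank of the differential of the end-point map is the dimension of
the orbit. -/
def IsRegular (H₀ H₁ ρ₀ : Mat n) (u : Control T) : Prop :=
  Module.finrank ℝ (LinearMap.range (dEnd H₀ H₁ ρ₀ u : Control T →ₗ[ℝ] Mat n)) =
    Module.finrank ℝ (tangentSpace ρ₀)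

/-- The objective on controls. -/
def cost (H₀ H₁ ρ₀ θ : Mat n) (u : Control T) : ℝ := objective θ (endMap H₀ H₁ ρ₀ u)

/-- The operator `dEnd* ∘ ∇²J ∘ dEnd` at `u`, with `∇²J` taken at the end point of `u`. -/
def hessianA (H₀ H₁ ρ₀ θ : Mat n) (u v : Control T) : Control T :=
  dEndAdj H₀ H₁ ρ₀ u (hessOp θ (endMap H₀ H₁ ρ₀ u) (dEnd H₀ H₁ ρ₀ u v))

end QControl

end

/-! ### Linear Volterra equations with an `L²` control -/

noncomputable section

namespace QControl

open Set

variable {T : ℝ} {V : Type*} [NormedAddCommGroup V] [NormedSpace ℝ V]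

/-! A point of the orbit is critical exactly when it commutes with `θ`. In the eigenbasis of `θ` the
critical points are thus the diagonal states whose entries are the eigenvalues `a` of `ρ₀` in some
order, and there are `n!` orders (`criticalPoints_eq_range`).

A line of controls moves the end point by conjugation with a curve of unitaries. At a point
commuting with `θ`, the second derivative of the objective along such a curve does not see the
acceleration, and sees the velocity `K` only through `⁅ρ, K⁆` (`deriv_deriv_objective_conj`,
`quadForm_congr`). Geodesics are such curves too, so the second derivative of the cost is the
Riemannian Hessian pulled back by `dEnd` (`fderiv_fderiv_cost`). Regularity makes `dEnd ∘ dEnd*`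
bijective on the tangent space (`exists_mem_adjImage`), so the signs taken on the image of the
adjoint are those of the Hessian of the objective.

In the eigenbasis that Hessian is `-∑ (a i - a j) (b i - b j) |L i j|²`, with `b` the eigenvalues of
`θ` (`quadForm_diag`). It is positive definite when the state is ordered oppositely to `b`, negative
definite when it is ordered like `b`, and indefinite otherwise. A transposition argument shows that
minimizers are oppositely ordered, and only one permutation is (`strictAntivary_of_forall_le`,
`eq_of_strictAntivary`); the maximum is the same with `-b`.

Smoothness comes from writing the trajectory as `(1 - L_u)⁻¹ ρ₀`, with `L_u` affine in the control
and of Volterra type, so that the inverse always exists (`isUnit_one_sub_fieldOp`, `contDiff_flow`).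
-/

theorem Control.integrableOn (u : Control T) : IntegrableOn u (Icc 0 T) :=
  (Lp.memLp u).integrable (by norm_num)

theorem Control.integrableOn_sq (u : Control T) : IntegrableOn (fun s => u s ^ 2) (Icc 0 T) :=
  (Lp.memLp u).integrable_sq

theorem Control.norm_sq_eq (u : Control T) : ‖u‖ ^ 2 = ∫ s in Icc 0 T, u s ^ 2 := by
  rw [← real_inner_self_eq_norm_sq, L2.inner_def]
  refine integral_congr_ae (.of_forall fun s => ?_)
  simp [sq]

theorem Control.integrableOn_smul (u : Control T) {x : ℝ → V} (hx : Continuous x) :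
    IntegrableOn (fun s => u s • x s) (Icc 0 T) :=
  u.integrableOn.smul_continuousOn hx.continuousOn isCompact_Icc

theorem Control.intervalIntegrable_smul (u : Control T) {x : ℝ → V} (hx : Continuous x) {t : ℝ}
    (ht : t ∈ Icc 0 T) : IntervalIntegrable (fun s => u s • x s) volume 0 t := by
  rw [intervalIntegrable_iff_integrableOn_Icc_of_le ht.1]
  exact (u.integrableOn_smul hx).mono_set (Icc_subset_Icc_right ht.2)

/-- Cauchy-Schwarz for the primitive of `u • x`. -/
theorem norm_integral_smul_sq_le (u : Control T) {x : ℝ → V} (hx : Continuous x) {t : ℝ}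
    (ht : t ∈ Icc 0 T) :
    ‖∫ s in (0 : ℝ)..t, u s • x s‖ ^ 2 ≤ ‖u‖ ^ 2 * ∫ s in (0 : ℝ)..t, ‖x s‖ ^ 2 := by
  have hsub : Ioc 0 t ⊆ Icc 0 T := fun s hs => ⟨hs.1.le, hs.2.trans ht.2⟩
  have hmeas : volume.restrict (Ioc 0 t) ≤ volume.restrict (Icc 0 T) :=
    Measure.restrict_mono hsub le_rfl
  have hu : MemLp (fun s => |u s|) (ENNReal.ofReal 2) (volume.restrict (Ioc 0 t)) := by
    simpa using ((Lp.memLp u).mono_measure hmeas).norm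
  have hx2 : MemLp (fun s => ‖x s‖) (ENNReal.ofReal 2) (volume.restrict (Ioc 0 t)) := by
    have h := (memLp_two_iff_integrable_sq (μ := volume.restrict (Ioc 0 t))
      hx.norm.aestronglyMeasurable).2
      ((hx.norm.pow 2).continuousOn.integrableOn_Icc.mono_set (Ioc_subset_Icc_self (b := t)))
    simpa using h
  have h1 := integral_mul_le_Lp_mul_Lq_of_nonneg (p := 2) (q := 2)
    (Real.HolderConjugate.two_two) (μ := volume.restrict (Ioc 0 t))
    (.of_forall fun s => abs_nonneg (u s)) (.of_forall fun s => norm_nonneg (x s)) hu hx2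
  have h2 : ‖∫ s in (0 : ℝ)..t, u s • x s‖ ≤ ∫ s in Ioc 0 t, |u s| * ‖x s‖ := by
    rw [intervalIntegral.integral_of_le ht.1]
    refine (norm_integral_le_integral_norm _).trans_eq ?_
    simp [norm_smul]
  have e1 : ∫ s in Ioc 0 t, |u s| ^ (2 : ℝ) ≤ ‖u‖ ^ 2 := by
    rw [u.norm_sq_eq]
    simp only [Real.rpow_two, sq_abs]
    exact setIntegral_mono_set u.integrableOn_sq (.of_forall fun s => sq_nonneg _)
      hsub.eventuallyLE
  have e2 : ∫ s in Ioc 0 t, ‖x s‖ ^ (2 : ℝ) = ∫ s in (0 : ℝ)..t, ‖x s‖ ^ 2 := by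
    simp only [Real.rpow_two, intervalIntegral.integral_of_le ht.1]
  have h3 := h2.trans h1
  rw [← Real.sqrt_eq_rpow, ← Real.sqrt_eq_rpow, e2] at h3
  have n1 : 0 ≤ ∫ s in Ioc 0 t, |u s| ^ (2 : ℝ) := integral_nonneg fun s => by positivity
  have n2 : 0 ≤ ∫ s in (0 : ℝ)..t, ‖x s‖ ^ 2 :=
    intervalIntegral.integral_nonneg ht.1 fun s _ => by positivity
  calc _ ≤ (√(∫ s in Ioc 0 t, |u s| ^ (2 : ℝ)) * √(∫ s in (0 : ℝ)..t, ‖x s‖ ^ 2)) ^ 2 :=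
        pow_le_pow_left₀ (norm_nonneg _) h3 2
    _ = (∫ s in Ioc 0 t, |u s| ^ (2 : ℝ)) * ∫ s in (0 : ℝ)..t, ‖x s‖ ^ 2 := by
        rw [mul_pow, Real.sq_sqrt n1, Real.sq_sqrt n2]
    _ ≤ _ := by gcongr

theorem integral_norm_sq_IccExtend_le {W : Type*} [NormedAddCommGroup W] (hT : 0 ≤ T)
    (x : C(Icc 0 T, W)) {t : ℝ} (ht : t ∈ Icc 0 T) :
    ∫ s in (0 : ℝ)..t, ‖IccExtend hT x s‖ ^ 2 ≤ T * ‖x‖ ^ 2 := by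
  have h : ∫ s in (0 : ℝ)..t, ‖IccExtend hT x s‖ ^ 2 ≤ ∫ _ in (0 : ℝ)..t, ‖x‖ ^ 2 := by
    refine intervalIntegral.integral_mono_on ht.1 ?_ (by simp) fun s _ => ?_
    · exact (x.continuous.Icc_extend'.norm.pow 2).intervalIntegrable _ _
    · exact pow_le_pow_left₀ (norm_nonneg _) (x.norm_coe_le_norm _) 2
  refine h.trans ?_
  simp only [intervalIntegral.integral_const, smul_eq_mul, sub_zero]
  gcongr
  exact ht.2

/-- The primitive of `u • x`. -/
def primitive (hT : 0 ≤ T) (u : Control T) (x : C(Icc 0 T, V)) : C(Icc 0 T, V) where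
  toFun t := ∫ s in (0 : ℝ)..t, u s • IccExtend hT x s
  continuous_toFun := by
    have h := intervalIntegral.continuousOn_primitive_interval (a := 0) (b := T) (μ := volume)
      (f := fun s => u s • IccExtend hT x s)
      (by rw [uIcc_of_le hT]; exact u.integrableOn_smul x.continuous.Icc_extend')
    rw [uIcc_of_le hT] at h
    exact continuousOn_iff_continuous_domRestrict.1 h

theorem primitive_apply (hT : 0 ≤ T) (u : Control T) (x : C(Icc 0 T, V)) (t : Icc 0 T) :
    primitive hT u x t = ∫ s in (0 : ℝ)..t, u s • IccExtend hT x s :=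
  rfl

theorem integral_congr_of_ae {f g : ℝ → V} (h : ∀ᵐ s ∂volume.restrict (Icc 0 T), f s = g s)
    {t : ℝ} (ht : t ∈ Icc 0 T) : ∫ s in (0 : ℝ)..t, f s = ∫ s in (0 : ℝ)..t, g s := by
  rw [intervalIntegral.integral_of_le ht.1, intervalIntegral.integral_of_le ht.1]
  have hsub : Ioc 0 t ⊆ Icc 0 T := fun s hs => ⟨hs.1.le, hs.2.trans ht.2⟩
  exact integral_congr_ae (ae_restrict_of_ae_restrict_of_subset hsub h)

/-- The bilinear map `(u, x) ↦ (t ↦ ∫₀ᵗ u x)`. -/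
def volterra (hT : 0 ≤ T) (V : Type*) [NormedAddCommGroup V] [NormedSpace ℝ V] :
    Control T →L[ℝ] C(Icc 0 T, V) →L[ℝ] C(Icc 0 T, V) :=
  LinearMap.mkContinuous₂
    (LinearMap.mk₂ ℝ (primitive hT)
      (fun u v x => by
        ext t
        have hc : Continuous (IccExtend hT x) := x.continuous.Icc_extend'
        rw [ContinuousMap.add_apply, primitive_apply, primitive_apply, primitive_apply,
          ← intervalIntegral.integral_add (u.intervalIntegrable_smul hc t.2)
          (v.intervalIntegrable_smul hc t.2)]
        refine integral_congr_of_ae ?_ t.2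
        filter_upwards [Lp.coeFn_add u v] with s hs
        rw [hs, Pi.add_apply, add_smul])
      (fun c u x => by
        ext t
        rw [ContinuousMap.smul_apply, primitive_apply, primitive_apply,
          ← intervalIntegral.integral_smul]
        refine integral_congr_of_ae ?_ t.2
        filter_upwards [Lp.coeFn_smul c u] with s hs
        rw [hs, Pi.smul_apply, smul_assoc])
      (fun u x y => by
        ext t
        rw [ContinuousMap.add_apply, primitive_apply, primitive_apply, primitive_apply,
          ← intervalIntegral.integral_add
          (u.intervalIntegrable_smul x.continuous.Icc_extend' t.2)
          (u.intervalIntegrable_smul y.continuous.Icc_extend' t.2)]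
        simp [IccExtend, smul_add])
      (fun c u x => by
        ext t
        rw [ContinuousMap.smul_apply, primitive_apply, primitive_apply,
          ← intervalIntegral.integral_smul]
        simp [IccExtend, smul_comm c]))
    -- Cauchy-Schwarz bounds the squared norm by `‖u‖² * (T * ‖x‖²)`.
    (√T) (fun u x => by
      rw [ContinuousMap.norm_le _ (by positivity)]
      intro t
      refine le_of_sq_le_sq ?_ (by positivity)
      refine (norm_integral_smul_sq_le u x.continuous.Icc_extend' t.2).trans ?_
      rw [mul_pow, mul_pow, Real.sq_sqrt hT, mul_comm T, mul_assoc]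
      gcongr
      exact integral_norm_sq_IccExtend_le hT x t.2)

/-- An operator on continuous paths of Volterra type, in the `L²` sense, is quasi-nilpotent. -/
theorem isUnit_one_sub_of_volterra [CompleteSpace V] (hT : 0 ≤ T)
    (L : C(Icc 0 T, V) →L[ℝ] C(Icc 0 T, V)) {C : ℝ} (hC : 0 ≤ C)
    (hL : ∀ x t, ‖L x t‖ ^ 2 ≤ C * ∫ s in (0 : ℝ)..t, ‖IccExtend hT x s‖ ^ 2) :
    IsUnit (1 - L) := by
  -- Iterating the estimate integrates `s ^ k / k!` at each stage, so the factorial beats any `C`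
  -- and `T`.
  have hpow : ∀ (k : ℕ) (x : C(Icc 0 T, V)) (t : Icc 0 T),
      ‖(L ^ k) x t‖ ^ 2 ≤ C ^ k * ((t : ℝ) ^ k / k.factorial) * ‖x‖ ^ 2 := by
    intro k
    induction k with
    | zero =>
      intro x t
      simpa using pow_le_pow_left₀ (norm_nonneg _) (x.norm_coe_le_norm t) 2
    | succ k ih =>
      intro x t
      rw [pow_succ' L]
      refine (hL _ t).trans ?_
      have h : ∫ s in (0 : ℝ)..t, ‖IccExtend hT ((L ^ k) x) s‖ ^ 2 ≤
          ∫ s in (0 : ℝ)..t, C ^ k * (s ^ k / k.factorial) * ‖x‖ ^ 2 := by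
        refine intervalIntegral.integral_mono_on t.2.1 ?_ ?_ fun s hs => ?_
        · exact (((L ^ k) x).continuous.Icc_extend'.norm.pow 2).intervalIntegrable _ _
        · exact Continuous.intervalIntegrable (by fun_prop) _ _
        · have hs' : s ∈ Icc 0 T := ⟨hs.1, hs.2.trans t.2.2⟩
          rw [IccExtend_of_mem _ _ hs']
          exact ih x ⟨s, hs'⟩
      refine (mul_le_mul_of_nonneg_left h hC).trans_eq ?_
      rw [intervalIntegral.integral_mul_const, intervalIntegral.integral_const_mul,
        intervalIntegral.integral_div, integral_pow, Nat.factorial_succ]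
      push_cast
      have : ((k : ℝ) + 1) ≠ 0 := by positivity
      have : (k.factorial : ℝ) ≠ 0 := by positivity
      field_simp
      simp [pow_succ']
      ring
  obtain ⟨k, hk⟩ : ∃ k : ℕ, (C * T) ^ k / k.factorial < 1 / 4 :=
    ((FloorSemiring.tendsto_pow_div_factorial_atTop (C * T)).eventually_lt_const
      (by norm_num)).exists
  have hnorm : ‖L ^ k‖ ≤ 1 / 2 := by
    refine ContinuousLinearMap.opNorm_le_bound _ (by norm_num) fun x => ?_
    rw [ContinuousMap.norm_le _ (by positivity)]
    intro t
    refine le_of_sq_le_sq ?_ (by positivity)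
    refine (hpow k x t).trans ?_
    rw [mul_pow]
    refine mul_le_mul_of_nonneg_right ?_ (by positivity)
    have ht := t.2.1
    calc C ^ k * ((t : ℝ) ^ k / k.factorial) ≤ C ^ k * (T ^ k / k.factorial) := by
          gcongr
          exact t.2.2
      _ = (C * T) ^ k / k.factorial := by rw [mul_pow]; ring
      _ ≤ _ := by norm_num at hk ⊢; exact hk.le
  have hu : IsUnit (1 - L ^ k) :=
    isUnit_one_sub_of_norm_lt_one (R := C(Icc 0 T, V) →L[ℝ] C(Icc 0 T, V)) (hnorm.trans_lt (by norm_num))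
  -- Only a power of `L` is small. Since `1 - L` is a commuting factor of the unit `1 - L ^ k`, it
  -- is a unit as well.
  have hfac : (1 - L) * (∑ i ∈ Finset.range k, L ^ i) = 1 - L ^ k := mul_neg_geom_sum L k
  have hcomm : Commute (1 - L) (∑ i ∈ Finset.range k, L ^ i) :=
    Commute.sum_right _ _ _ fun i _ =>
      (Commute.one_left _).sub_left ((Commute.refl L).pow_right i)
  rw [← hfac] at hu
  exact (hcomm.isUnit_mul_iff.1 hu).1

/-- The constant control `1`. -/
def oneControl (T : ℝ) : Control T := (memLp_const (1 : ℝ)).toLp (fun _ => (1 : ℝ))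

/-- The drift is treated as a term driven by the control `1`, so that one bilinear map serves both
terms of the field. -/
theorem oneControl_ae : ∀ᵐ s ∂volume.restrict (Icc 0 T), oneControl T s = 1 :=
  MemLp.coeFn_toLp _

/-- The operator `x ↦ (t ↦ ∫₀ᵗ (A₀ + u A₁) x)`. -/
def fieldOp (hT : 0 ≤ T) (A₀ A₁ : V →L[ℝ] V) (u : Control T) :
    C(Icc 0 T, V) →L[ℝ] C(Icc 0 T, V) :=
  volterra hT V (oneControl T) ∘L A₀.compLeftContinuous ℝ (Icc 0 T) +
    volterra hT V u ∘L A₁.compLeftContinuous ℝ (Icc 0 T)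

theorem fieldOp_apply (hT : 0 ≤ T) (A₀ A₁ : V →L[ℝ] V) (u : Control T) (x : C(Icc 0 T, V))
    (t : Icc 0 T) : fieldOp hT A₀ A₁ u x t =
      ∫ s in (0 : ℝ)..t, (A₀ (IccExtend hT x s) + u s • A₁ (IccExtend hT x s)) := by
  have hc : Continuous (IccExtend hT x) := x.continuous.Icc_extend'
  have h1 := (oneControl T).intervalIntegrable_smul (A₀.continuous.comp hc) t.2
  have h2 := u.intervalIntegrable_smul (A₁.continuous.comp hc) t.2
  refine (intervalIntegral.integral_add h1 h2).symm.trans ?_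
  refine integral_congr_of_ae ?_ t.2
  filter_upwards [oneControl_ae] with s hs
  simp [hs]

/-- Each term satisfies the Volterra estimate, and `(p + q)² ≤ 2p² + 2q²` combines them. Neither `T`
nor `u` has to be small. -/
theorem isUnit_one_sub_fieldOp [CompleteSpace V] (hT : 0 ≤ T) (A₀ A₁ : V →L[ℝ] V)
    (u : Control T) : IsUnit (1 - fieldOp hT A₀ A₁ u) := by
  have key : ∀ (A : V →L[ℝ] V) (v : Control T) (x : C(Icc 0 T, V)) (t : Icc 0 T),
      ‖volterra hT V v (A.compLeftContinuous ℝ (Icc 0 T) x) t‖ ^ 2 ≤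
        (‖v‖ * ‖A‖) ^ 2 * ∫ s in (0 : ℝ)..t, ‖IccExtend hT x s‖ ^ 2 := by
    intro A v x t
    have hc : Continuous (IccExtend hT x) := x.continuous.Icc_extend'
    refine (norm_integral_smul_sq_le v (A.continuous.comp hc) t.2).trans ?_
    rw [mul_pow, mul_assoc, ← intervalIntegral.integral_const_mul (‖A‖ ^ 2)]
    refine mul_le_mul_of_nonneg_left ?_ (by positivity)
    refine intervalIntegral.integral_mono_on t.2.1
      (((A.continuous.comp hc).norm.pow 2).intervalIntegrable _ _)
      ((continuous_const.mul (hc.norm.pow 2)).intervalIntegrable _ _) fun s _ => ?_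
    rw [← mul_pow]
    exact pow_le_pow_left₀ (norm_nonneg _) (A.le_opNorm _) 2
  refine isUnit_one_sub_of_volterra hT _
    (C := 2 * (‖oneControl T‖ * ‖A₀‖) ^ 2 + 2 * (‖u‖ * ‖A₁‖) ^ 2) (by positivity) fun x t => ?_
  have k0 := key A₀ (oneControl T) x t
  have k1 := key A₁ u x t
  have h := norm_add_le (E := V) (volterra hT V (oneControl T) (A₀.compLeftContinuous ℝ (Icc 0 T) x) t)
    (volterra hT V u (A₁.compLeftContinuous ℝ (Icc 0 T) x) t)
  refine (pow_le_pow_left₀ (norm_nonneg _) h 2).trans (add_sq_le.trans ?_)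
  linarith

/-- The solution of `x = x₀ + ∫ (A₀ + u A₁) x`. -/
def flow (hT : 0 ≤ T) (A₀ A₁ : V →L[ℝ] V) (x₀ : V) (u : Control T) : C(Icc 0 T, V) :=
  Ring.inverse (1 - fieldOp hT A₀ A₁ u) (ContinuousMap.const _ x₀)

variable [CompleteSpace V]

/-- Invertibility of `1 - fieldOp` gives existence and uniqueness of the Carathéodory solution at
once. -/
theorem eq_flow_iff (hT : 0 ≤ T) (A₀ A₁ : V →L[ℝ] V) (x₀ : V) (u : Control T)
    (x : C(Icc 0 T, V)) : x = flow hT A₀ A₁ x₀ u ↔ ∀ t : Icc 0 T, x t =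
      x₀ + ∫ s in (0 : ℝ)..t, (A₀ (IccExtend hT x s) + u s • A₁ (IccExtend hT x s)) := by
  have hU := isUnit_one_sub_fieldOp hT A₀ A₁ u
  have h1 := Ring.inverse_mul_cancel _ hU
  have h2 := Ring.mul_inverse_cancel _ hU
  have h3 : x = flow hT A₀ A₁ x₀ u ↔
      (1 - fieldOp hT A₀ A₁ u) x = ContinuousMap.const _ x₀ := by
    constructor
    · rintro rfl
      exact DFunLike.congr_fun h2 _
    · intro h
      rw [flow, ← h]
      exact (DFunLike.congr_fun h1 x).symm
  rw [h3, ContinuousMap.ext_iff]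
  refine forall_congr' fun t => ?_
  rw [← fieldOp_apply]
  change x t - fieldOp hT A₀ A₁ u x t = x₀ ↔ _
  rw [sub_eq_iff_eq_add]

/-- The operator is affine in `u`, and inversion is smooth at units of a Banach algebra. -/
theorem contDiff_flow (hT : 0 ≤ T) (A₀ A₁ : V →L[ℝ] V) (x₀ : V) {k : WithTop ℕ∞} :
    ContDiff ℝ k (flow hT A₀ A₁ x₀) := by
  have hS : ContDiff ℝ k fun u : Control T => 1 - fieldOp hT A₀ A₁ u := by
    unfold fieldOp
    have h : ContDiff ℝ k fun u : Control T =>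
        volterra hT V u ∘L A₁.compLeftContinuous ℝ (Icc 0 T) :=
      (volterra hT V).contDiff.clm_comp contDiff_const
    exact contDiff_const.sub (contDiff_const.add h)
  have hI : ContDiff ℝ k fun u : Control T => Ring.inverse (1 - fieldOp hT A₀ A₁ u) :=
    contDiff_iff_contDiffAt.2 fun u => by
      have h := contDiffAt_ringInverse (n := k) ℝ
        (R := C(Icc 0 T, V) →L[ℝ] C(Icc 0 T, V)) (isUnit_one_sub_fieldOp hT A₀ A₁ u).unit
      rw [IsUnit.unit_spec] at h
      exact h.comp u hS.contDiffAt
  exact hI.clm_apply contDiff_const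

end QControl

end

/-! ### Trajectories and the propagator -/

noncomputable section

namespace QControl

open Set

/-- For a continuous control the flow solves the differential equation classically. -/
theorem exists_hasDerivAt_flow {T : ℝ} {V : Type*} [NormedAddCommGroup V] [NormedSpace ℝ V]
    [CompleteSpace V] (hT : 0 ≤ T) (A₀ A₁ : V →L[ℝ] V) (x₀ : V) (f : BoundedContinuousFunction ℝ ℝ)
    {u : Control T} (hu : ∀ᵐ s ∂volume.restrict (Icc 0 T), u s = f s) :
    ∃ y : ℝ → V, y 0 = x₀ ∧ (∀ t : Icc 0 T, y t = flow hT A₀ A₁ x₀ u t) ∧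
      ∀ t ∈ Icc 0 T, HasDerivAt y (A₀ (y t) + f t • A₁ (y t)) t := by
  set x := flow hT A₀ A₁ x₀ u with hx
  have hc : Continuous (IccExtend hT x) := x.continuous.Icc_extend'
  have hg : Continuous fun s => A₀ (IccExtend hT x s) + f s • A₁ (IccExtend hT x s) := by fun_prop
  have hy : ∀ t : Icc 0 T, x₀ + ∫ s in (0 : ℝ)..t,
      (A₀ (IccExtend hT x s) + f s • A₁ (IccExtend hT x s)) = x t := by
    intro t
    rw [(eq_flow_iff hT A₀ A₁ x₀ u x).1 hx t]
    congr 1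
    refine integral_congr_of_ae ?_ t.2
    filter_upwards [hu] with s hs
    rw [hs]
  refine ⟨fun t => x₀ + ∫ s in (0 : ℝ)..t,
    (A₀ (IccExtend hT x s) + f s • A₁ (IccExtend hT x s)), by simp, hy, fun t ht => ?_⟩
  have h := (intervalIntegral.integral_hasDerivAt_right (hg.intervalIntegrable 0 t)
    hg.stronglyMeasurable.stronglyMeasurableAtFilter hg.continuousAt).const_add x₀
  have e : IccExtend hT x t = x₀ + ∫ s in (0 : ℝ)..t,
      (A₀ (IccExtend hT x s) + f s • A₁ (IccExtend hT x s)) := by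
    rw [hy ⟨t, ht⟩, IccExtend_of_mem _ _ ht]
  simp only [← e]
  exact h

/-- Closed identities in the control need checking only for continuous controls, where the product
rule applies classically. -/
theorem denseRange_toLp (T : ℝ) : DenseRange fun f : BoundedContinuousFunction ℝ ℝ =>
    (BoundedContinuousFunction.toLp 2 (volume.restrict (Icc 0 T)) ℝ f : Control T) :=
  BoundedContinuousFunction.toLp_denseRange ℝ (volume.restrict (Icc 0 T)) ℝ (by norm_num)

variable {n : ℕ} {T : ℝ}

/-- Commutator with `H`. -/
def adL (H : Mat n) : Mat n →L[ℝ] Mat n :=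
  ContinuousLinearMap.mul ℝ (Mat n) H - (ContinuousLinearMap.mul ℝ (Mat n)).flip H

@[simp]
theorem adL_apply (H ρ : Mat n) : adL H ρ = ⁅H, ρ⁆ := rfl

/-- A trajectory is unconstrained outside `[0,T]`, so uniqueness can only be asserted on that
interval. -/
theorem isTrajectory_iff (hT : 0 ≤ T) (H₀ H₁ ρ₀ : Mat n) (u : Control T) (ρ : ℝ → Mat n) :
    IsTrajectory H₀ H₁ ρ₀ u ρ ↔ ∀ t : Icc 0 T, ρ t = flow hT (adL H₀) (adL H₁) ρ₀ u t := by
  have key : ∀ x : C(Icc 0 T, Mat n), (∀ t : Icc 0 T, ρ t = x t) →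
      ((∀ t ∈ Icc 0 T, ρ t = ρ₀ + ∫ s in (0 : ℝ)..t, ⁅H₀ + u s • H₁, ρ s⁆) ↔
        x = flow hT (adL H₀) (adL H₁) ρ₀ u) := by
    intro x hx
    rw [eq_flow_iff, Subtype.forall']
    refine forall_congr' fun t => ?_
    have e : ∫ s in (0 : ℝ)..t, ⁅H₀ + u s • H₁, ρ s⁆ = ∫ s in (0 : ℝ)..t,
        (adL H₀ (IccExtend hT x s) + u s • adL H₁ (IccExtend hT x s)) := by
      refine intervalIntegral.integral_congr fun s hs => ?_
      rw [uIcc_of_le t.2.1] at hs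
      have hs' : s ∈ Icc 0 T := ⟨hs.1, hs.2.trans t.2.2⟩
      simp only [IccExtend_of_mem _ _ hs', ← hx, adL_apply, Ring.lie_def, add_mul, mul_add,
        smul_mul_assoc, mul_smul_comm, smul_sub]
      abel
    rw [hx t, e]
  constructor
  · rintro ⟨hc, h⟩ t
    let x : C(Icc 0 T, Mat n) := ⟨fun t => ρ t, continuousOn_iff_continuous_domRestrict.1 hc⟩
    exact DFunLike.congr_fun ((key x fun _ => rfl).1 h) t
  · intro h
    refine ⟨?_, (key _ h).2 rfl⟩
    refine continuousOn_iff_continuous_domRestrict.2 ?_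
    rw [show (Icc 0 T).domRestrict ρ = flow hT (adL H₀) (adL H₁) ρ₀ u from funext h]
    exact (flow hT (adL H₀) (adL H₁) ρ₀ u).continuous

theorem endMap_eq_flow (hT : 0 ≤ T) (H₀ H₁ ρ₀ : Mat n) (u : Control T) :
    endMap H₀ H₁ ρ₀ u = flow hT (adL H₀) (adL H₁) ρ₀ u ⟨T, right_mem_Icc.2 hT⟩ := by
  have h : IsTrajectory H₀ H₁ ρ₀ u (Classical.epsilon (IsTrajectory H₀ H₁ ρ₀ u)) := by
    refine Classical.epsilon_spec
      (⟨IccExtend hT (flow hT (adL H₀) (adL H₁) ρ₀ u), ?_⟩ :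
        ∃ ρ, IsTrajectory H₀ H₁ ρ₀ u ρ)
    rw [isTrajectory_iff hT]
    intro t
    simp
  exact (isTrajectory_iff hT H₀ H₁ ρ₀ u _).1 h ⟨T, right_mem_Icc.2 hT⟩

/-- The propagator at time `T` of the Schrödinger equation `X' = (H₀ + u H₁) X`, `X(0) = 1`. -/
def propagator (hT : 0 ≤ T) (H₀ H₁ : Mat n) (u : Control T) : Mat n :=
  flow hT (ContinuousLinearMap.mul ℝ (Mat n) H₀) (ContinuousLinearMap.mul ℝ (Mat n) H₁) 1 u
    ⟨T, right_mem_Icc.2 hT⟩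

theorem contDiff_eval_flow {V : Type*} [NormedAddCommGroup V] [NormedSpace ℝ V] [CompleteSpace V]
    (hT : 0 ≤ T) (A₀ A₁ : V →L[ℝ] V) (x₀ : V) (t : Icc 0 T) {k : WithTop ℕ∞} :
    ContDiff ℝ k fun u : Control T => flow hT A₀ A₁ x₀ u t :=
  (ContinuousMap.evalCLM ℝ t).contDiff.comp (contDiff_flow hT A₀ A₁ x₀)

theorem contDiff_propagator (hT : 0 ≤ T) (H₀ H₁ : Mat n) {k : WithTop ℕ∞} :
    ContDiff ℝ k (propagator hT H₀ H₁ : Control T → Mat n) :=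
  contDiff_eval_flow hT _ _ _ _

theorem contDiff_endMap (hT : 0 ≤ T) (H₀ H₁ ρ₀ : Mat n) {k : WithTop ℕ∞} :
    ContDiff ℝ k (endMap H₀ H₁ ρ₀ : Control T → Mat n) := by
  rw [funext (endMap_eq_flow hT H₀ H₁ ρ₀)]
  exact contDiff_eval_flow hT _ _ _ _

theorem eq_of_hasDerivAt_zero {V : Type*} [NormedAddCommGroup V] [NormedSpace ℝ V] (hT : 0 ≤ T)
    {f : ℝ → V} (hf : ∀ t ∈ Icc 0 T, HasDerivAt f 0 t) : f T = f 0 :=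
  constant_of_has_deriv_right_zero (fun t ht => (hf t ht).continuousAt.continuousWithinAt)
    (fun t ht => (hf t ⟨ht.1, ht.2.le⟩).hasDerivWithinAt) T (right_mem_Icc.2 hT)

theorem su_conjTranspose_add_smul {H₀ H₁ : Mat n} (hH₀ : H₀ ∈ su n) (hH₁ : H₁ ∈ su n) (c : ℝ) :
    star (H₀ + c • H₁) = -(H₀ + c • H₁) :=
  ((su n).add_mem hH₀ ((su n).smul_mem c hH₁)).1

/-- The propagator is unitary and conjugates the initial state to the final one. -/
theorem propagator_spec (hT : 0 ≤ T) {H₀ H₁ : Mat n} (hH₀ : H₀ ∈ su n) (hH₁ : H₁ ∈ su n)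
    (ρ₀ : Mat n) (u : Control T) :
    star (propagator hT H₀ H₁ u) * propagator hT H₀ H₁ u = 1 ∧
      star (propagator hT H₀ H₁ u) * endMap H₀ H₁ ρ₀ u * propagator hT H₀ H₁ u = ρ₀ := by
  have hX : Continuous (propagator hT H₀ H₁ : Control T → Mat n) :=
    (contDiff_propagator (k := 0) hT H₀ H₁).continuous
  have hE : Continuous (endMap H₀ H₁ ρ₀ : Control T → Mat n) :=
    (contDiff_endMap (k := 0) hT H₀ H₁ ρ₀).continuous
  refine (denseRange_toLp T).induction_on (p := fun u =>
    star (propagator hT H₀ H₁ u) * propagator hT H₀ H₁ u = 1 ∧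
      star (propagator hT H₀ H₁ u) * endMap H₀ H₁ ρ₀ u * propagator hT H₀ H₁ u = ρ₀) u ?_ ?_
  · exact (isClosed_eq (hX.star.mul hX) continuous_const).inter
      (isClosed_eq ((hX.star.mul hE).mul hX) continuous_const)
  intro f
  have hf := BoundedContinuousFunction.coeFn_toLp (p := 2) (𝕜 := ℝ) (volume.restrict (Icc 0 T)) f
  set u : Control T := BoundedContinuousFunction.toLp 2 (volume.restrict (Icc 0 T)) ℝ f
  obtain ⟨X, hX0, hXT, hX'⟩ := exists_hasDerivAt_flow hT (ContinuousLinearMap.mul ℝ (Mat n) H₀)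
    (ContinuousLinearMap.mul ℝ (Mat n) H₁) 1 f hf
  obtain ⟨ρ, hρ0, hρT, hρ'⟩ := exists_hasDerivAt_flow hT (adL H₀) (adL H₁) ρ₀ f hf
  rw [endMap_eq_flow hT, ← hρT, propagator, ← hXT]
  have hXd : ∀ t ∈ Icc 0 T, HasDerivAt X ((H₀ + f t • H₁) * X t) t := fun t ht =>
    (hX' t ht).congr_deriv (by simp [add_mul])
  have hρd : ∀ t ∈ Icc 0 T, HasDerivAt ρ
      ((H₀ + f t • H₁) * ρ t - ρ t * (H₀ + f t • H₁)) t := fun t ht =>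
    (hρ' t ht).congr_deriv (by
      simp only [adL_apply, Ring.lie_def, add_mul, mul_add, smul_mul_assoc, mul_smul_comm,
        smul_sub]
      abel)
  constructor
  -- The generator is skew-Hermitian, so its two contributions cancel; the same happens below for
  -- the state pulled back by `X`.
  · have h : ∀ t ∈ Icc 0 T, HasDerivAt (fun t => star (X t) * X t) 0 t := fun t ht =>
      ((hXd t ht).star.mul (hXd t ht)).congr_deriv (by
        rw [star_mul, su_conjTranspose_add_smul hH₀ hH₁]
        noncomm_ring)
    simpa [hX0] using eq_of_hasDerivAt_zero hT h
  · have h : ∀ t ∈ Icc 0 T, HasDerivAt (fun t => star (X t) * ρ t * X t) 0 t := fun t ht =>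
      (((hXd t ht).star.mul (hρd t ht)).mul (hXd t ht)).congr_deriv (by
        rw [star_mul, su_conjTranspose_add_smul hH₀ hH₁]
        simp only [Pi.mul_apply]
        noncomm_ring)
    simpa [hX0, hρ0] using eq_of_hasDerivAt_zero hT h

end QControl

end

/-! ### Horizontal lifts and the invariant metric -/

noncomputable section

namespace QControl

open scoped ComplexOrder

variable {n : ℕ}

theorem mem_tangentSpace {ρ ξ : Mat n} : ξ ∈ tangentSpace ρ ↔ ∃ Ω ∈ su n, ⁅ρ, Ω⁆ = ξ := Iff.rfl

theorem lie_add_right (ρ A B : Mat n) : ⁅ρ, A + B⁆ = ⁅ρ, A⁆ + ⁅ρ, B⁆ := by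
  simp only [Ring.lie_def, mul_add, add_mul]
  abel

theorem lie_sub_right (ρ A B : Mat n) : ⁅ρ, A - B⁆ = ⁅ρ, A⁆ - ⁅ρ, B⁆ := by
  simp only [Ring.lie_def, mul_sub, sub_mul]
  abel

theorem lie_smul_right (ρ : Mat n) (c : ℝ) (A : Mat n) : ⁅ρ, c • A⁆ = c • ⁅ρ, A⁆ := by
  simp only [Ring.lie_def, mul_smul_comm, smul_mul_assoc, smul_sub]

theorem lie_zero_right (ρ : Mat n) : ⁅ρ, (0 : Mat n)⁆ = 0 := by
  simp [Ring.lie_def]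

/-- The real part of the Hilbert-Schmidt product. -/
def hsForm (n : ℕ) : LinearMap.BilinForm ℝ (Mat n) :=
  LinearMap.mk₂ ℝ (fun A B => (Aᴴ * B).trace.re)
    (fun A B C => by simp [add_mul]) (fun c A B => by simp)
    (fun A B C => by simp [mul_add]) (fun c A B => by simp)

theorem hsForm_apply (A B : Mat n) : hsForm n A B = (Aᴴ * B).trace.re := rfl

theorem hsForm_comm (A B : Mat n) : hsForm n A B = hsForm n B A := by
  rw [hsForm_apply, hsForm_apply, ← Complex.conj_re, starRingEnd_apply,
    ← Matrix.trace_conjTranspose]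
  simp

/-- The Hilbert-Schmidt product of skew-Hermitian matrices is real, so the complex condition in
`horizontal` is orthogonality for the real form `hsForm`. -/
theorem trace_im_eq_zero {A B : Mat n} (hA : Aᴴ = -A) (hB : Bᴴ = -B) : (Aᴴ * B).trace.im = 0 := by
  rw [← Complex.conj_eq_iff_im, starRingEnd_apply, ← Matrix.trace_conjTranspose,
    Matrix.conjTranspose_mul, Matrix.conjTranspose_conjTranspose, hA, hB, Matrix.trace_mul_comm]
  simp

theorem trace_conjTranspose_mul_eq_zero_iff {A B : Mat n} (hA : Aᴴ = -A) (hB : Bᴴ = -B) :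
    (Aᴴ * B).trace = 0 ↔ hsForm n A B = 0 := by
  rw [Complex.ext_iff, trace_im_eq_zero hA hB]
  simp [hsForm_apply]

theorem hsForm_self_eq_zero {A : Mat n} (h : hsForm n A A = 0) : A = 0 := by
  have h2 := (Complex.le_def.1 (Matrix.posSemidef_conjTranspose_mul_self A).trace_nonneg).2
  exact Matrix.trace_conjTranspose_mul_self_eq_zero_iff.1 (Complex.ext h h2.symm)

/-- The stabilizer algebra of `ρ`. -/
def stabilizer (ρ : Mat n) : Submodule ℝ (Mat n) :=
  su n ⊓ LinearMap.ker (LinearMap.mulLeft ℝ ρ - LinearMap.mulRight ℝ ρ)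

theorem mem_stabilizer {ρ Ω : Mat n} : Ω ∈ stabilizer ρ ↔ Ω ∈ su n ∧ ⁅ρ, Ω⁆ = 0 := Iff.rfl

theorem mem_horizontal {ρ Ω : Mat n} :
    Ω ∈ horizontal ρ ↔ Ω ∈ su n ∧ ∀ Z ∈ stabilizer ρ, hsForm n Z Ω = 0 := by
  refine and_congr_right fun hΩ => ⟨fun h Z hZ => ?_, fun h Z hZ h0 => ?_⟩
  · rw [hsForm_comm]
    exact (trace_conjTranspose_mul_eq_zero_iff hΩ.1 hZ.1.1).1 (h Z hZ.1 hZ.2)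
  · rw [trace_conjTranspose_mul_eq_zero_iff hΩ.1 hZ.1, hsForm_comm]
    exact h Z ⟨hZ, h0⟩

/-- The form is definite, so the stabilizer has an orthogonal complement; removing the stabilizer
component does not change the commutator. -/
theorem exists_horizontal (ρ : Mat n) {Ω : Mat n} (hΩ : Ω ∈ su n) :
    ∃ Ω' ∈ horizontal ρ, ⁅ρ, Ω'⁆ = ⁅ρ, Ω⁆ := by
  have hrefl : (hsForm n).IsRefl := fun A B h => by rw [hsForm_comm, h]
  have hcompl : IsCompl (stabilizer ρ) ((hsForm n).orthogonal (stabilizer ρ)) := by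
    rw [LinearMap.BilinForm.isCompl_orthogonal_iff_disjoint hrefl, Submodule.disjoint_def]
    intro Z hZ hZ'
    exact hsForm_self_eq_zero (LinearMap.BilinForm.mem_orthogonal_iff.1 hZ' Z hZ)
  obtain ⟨Z, hZ, Ω', hΩ', h⟩ := Submodule.mem_sup.1
    (hcompl.sup_eq_top ▸ Submodule.mem_top : Ω ∈ stabilizer ρ ⊔ _)
  have e : Ω' = Ω - Z := by rw [← h]; abel
  refine ⟨Ω', mem_horizontal.2 ⟨?_, LinearMap.BilinForm.mem_orthogonal_iff.1 hΩ'⟩, ?_⟩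
  · rw [e]
    exact (su n).sub_mem hΩ hZ.1
  · rw [e, lie_sub_right, (mem_stabilizer.1 hZ).2, sub_zero]

theorem lift_spec {ρ ξ : Mat n} (hξ : ξ ∈ tangentSpace ρ) :
    lift ρ ξ ∈ horizontal ρ ∧ ⁅ρ, lift ρ ξ⁆ = ξ := by
  obtain ⟨Ω, hΩ, rfl⟩ := mem_tangentSpace.1 hξ
  exact Classical.epsilon_spec (exists_horizontal ρ hΩ)

/-- Two horizontal lifts of `ξ` differ by a stabilizer element that is orthogonal to itself. -/
theorem lift_eq {ρ ξ Ω : Mat n} (hΩ : Ω ∈ horizontal ρ) (h : ⁅ρ, Ω⁆ = ξ) : lift ρ ξ = Ω := by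
  obtain ⟨h1, h2⟩ := lift_spec (mem_tangentSpace.2 ⟨Ω, hΩ.1, h⟩)
  rw [mem_horizontal] at h1 hΩ
  have hZ : lift ρ ξ - Ω ∈ stabilizer ρ :=
    mem_stabilizer.2 ⟨(su n).sub_mem h1.1 hΩ.1, by rw [lie_sub_right, h2, h, sub_self]⟩
  refine sub_eq_zero.1 (hsForm_self_eq_zero ?_)
  rw [map_sub (hsForm n (lift ρ ξ - Ω))]
  rw [h1.2 _ hZ, hΩ.2 _ hZ, sub_zero]

theorem lift_add {ρ ξ η : Mat n} (hξ : ξ ∈ tangentSpace ρ) (hη : η ∈ tangentSpace ρ) :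
    lift ρ (ξ + η) = lift ρ ξ + lift ρ η := by
  obtain ⟨h1, h2⟩ := lift_spec hξ
  obtain ⟨h3, h4⟩ := lift_spec hη
  refine lift_eq (mem_horizontal.2 ⟨(su n).add_mem h1.1 h3.1, fun Z hZ => ?_⟩) ?_
  · rw [map_add, (mem_horizontal.1 h1).2 Z hZ, (mem_horizontal.1 h3).2 Z hZ, add_zero]
  · rw [lie_add_right, h2, h4]

theorem lift_smul {ρ ξ : Mat n} (c : ℝ) (hξ : ξ ∈ tangentSpace ρ) :
    lift ρ (c • ξ) = c • lift ρ ξ := by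
  obtain ⟨h1, h2⟩ := lift_spec hξ
  refine lift_eq (mem_horizontal.2 ⟨(su n).smul_mem c h1.1, fun Z hZ => ?_⟩) ?_
  · rw [map_smul, (mem_horizontal.1 h1).2 Z hZ, smul_zero]
  · rw [lie_smul_right, h2]

/-- The horizontal lift as a linear map. -/
def liftLin (ρ : Mat n) : tangentSpace ρ →ₗ[ℝ] Mat n where
  toFun ξ := lift ρ ξ
  map_add' ξ η := lift_add ξ.2 η.2
  map_smul' c ξ := lift_smul c ξ.2

/-- The metric as a bilinear form on the tangent space. -/
def metricForm (ρ : Mat n) : LinearMap.BilinForm ℝ (tangentSpace ρ) :=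
  (hsForm n).compl₁₂ (liftLin ρ) (liftLin ρ)

theorem metricForm_self_eq_zero {ρ : Mat n} {ξ : tangentSpace ρ} (h : metricForm ρ ξ ξ = 0) :
    ξ = 0 := by
  have h0 : lift ρ ξ = 0 := hsForm_self_eq_zero h
  have h2 := (lift_spec ξ.2).2
  rw [h0, lie_zero_right] at h2
  exact Subtype.ext h2.symm

/-- Riesz representation on the tangent space. -/
theorem exists_metricForm_eq (ρ : Mat n) (φ : tangentSpace ρ →ₗ[ℝ] ℝ) :
    ∃ ζ, ∀ η, metricForm ρ ζ η = φ η := by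
  have hinj : Function.Injective (metricForm ρ) := by
    refine (injective_iff_map_eq_zero _).2 fun ξ h => metricForm_self_eq_zero (ρ := ρ) ?_
    rw [h, LinearMap.zero_apply]
  obtain ⟨ζ, h⟩ := (LinearMap.injective_iff_surjective_of_finrank_eq_finrank
    (Subspace.dual_finrank_eq).symm).1 hinj φ
  exact ⟨ζ, fun η => by rw [h]⟩

/-- The trace part of `K` is scalar and commutes with `ρ`, so curves of unitaries of any determinant
have tangent velocities. -/
theorem lie_mem_tangentSpace (ρ : Mat n) {K : Mat n} (hK : Kᴴ = -K) : ⁅ρ, K⁆ ∈ tangentSpace ρ := by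
  have htr : star K.trace = -K.trace := by
    rw [← Matrix.trace_conjTranspose, hK, Matrix.trace_neg]
  refine mem_tangentSpace.2 ⟨K - (K.trace / n) • (1 : Mat n), ⟨?_, ?_⟩, ?_⟩
  · rw [Matrix.conjTranspose_sub, Matrix.conjTranspose_smul, hK, star_div₀, htr]
    simp [neg_div, neg_add_eq_sub]
  · rcases Nat.eq_zero_or_pos n with rfl | hn
    · simp
    · have : (n : ℂ) ≠ 0 := by exact_mod_cast hn.ne'
      simp [this]
  · simp [Ring.lie_def, mul_sub, sub_mul]

/-- The dimension of the tangent space is constant along unitary orbits. -/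
theorem finrank_tangentSpace_conj {U : Mat n} (hU : star U * U = 1) (ρ : Mat n) :
    Module.finrank ℝ (tangentSpace (U * ρ * star U)) = Module.finrank ℝ (tangentSpace ρ) := by
  have hU' : U * star U = 1 := mul_eq_one_comm.1 hU
  let e : Mat n ≃ₗ[ℝ] Mat n :=
    { toFun := fun A => U * A * star U
      invFun := fun A => star U * A * U
      map_add' := fun A B => by simp [mul_add, add_mul]
      map_smul' := fun c A => by simp
      left_inv := fun A => by
        simp only [mul_assoc, hU, mul_one]; rw [← mul_assoc, hU, one_mul]
      right_inv := fun A => by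
        simp only [mul_assoc, hU', mul_one]; rw [← mul_assoc, hU', one_mul] }
  have he : ∀ A, e A = U * A * star U := fun A => rfl
  have hes : ∀ A, e.symm A = star U * A * U := fun A => rfl
  have hmul : ∀ A B, e (A * B) = e A * e B := fun A B => by
    simp only [he, mul_assoc]
    rw [← mul_assoc (star U) U, hU, one_mul]
  have hsu : ∀ A ∈ su n, e A ∈ su n := fun A hA => by
    refine ⟨?_, ?_⟩
    · rw [he, ← Matrix.star_eq_conjTranspose, star_mul, star_mul, star_star,
        Matrix.star_eq_conjTranspose A, hA.1]
      simp [mul_assoc]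
    · rw [he, Matrix.trace_mul_comm, ← mul_assoc, hU, one_mul, hA.2]
  have hsu' : ∀ A ∈ su n, e.symm A ∈ su n := fun A hA => by
    refine ⟨?_, ?_⟩
    · rw [hes, ← Matrix.star_eq_conjTranspose, star_mul, star_mul, star_star,
        Matrix.star_eq_conjTranspose A, hA.1]
      simp [mul_assoc]
    · rw [hes, Matrix.trace_mul_comm, ← mul_assoc, hU', one_mul, hA.2]
  have h : tangentSpace (e ρ) = (tangentSpace ρ).map (e : Mat n →ₗ[ℝ] Mat n) := by
    ext ξ
    simp only [Submodule.mem_map, mem_tangentSpace]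
    constructor
    · rintro ⟨Ω, hΩ, rfl⟩
      refine ⟨_, ⟨e.symm Ω, hsu' Ω hΩ, rfl⟩, ?_⟩
      simp [Ring.lie_def, hmul]
    · rintro ⟨_, ⟨Ω, hΩ, rfl⟩, rfl⟩
      refine ⟨e Ω, hsu Ω hΩ, ?_⟩
      simp [Ring.lie_def, hmul]
  rw [← he, h]
  exact LinearEquiv.finrank_map_eq e _

end QControl

end

/-! ### The Hessian at a critical point -/

noncomputable section

namespace QControl

variable {n : ℕ}

/-- The second derivative of the objective along `Y * ρ * Yᴴ`, where `Y` is a curve of unitaries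
through `1` with velocity `K`, at a critical point `ρ`. -/
def quadForm (θ ρ K : Mat n) : ℝ := ((K * K * ρ - 2 * (K * ρ * K) + ρ * (K * K)) * θ).trace.re

theorem quadForm_neg (θ ρ K : Mat n) : quadForm θ ρ (-K) = quadForm θ ρ K := by
  simp [quadForm]

theorem quadForm_smul (θ ρ K : Mat n) (c : ℝ) : quadForm θ ρ (c • K) = c ^ 2 * quadForm θ ρ K := by
  have h : c • K * c • K * ρ - 2 * (c • K * ρ * c • K) + ρ * (c • K * c • K) =
      (c ^ 2) • (K * K * ρ - 2 * (K * ρ * K) + ρ * (K * K)) := by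
    simp only [smul_mul_assoc, mul_smul_comm, smul_add, smul_sub, smul_smul, sq]
  rw [quadForm, quadForm, h, smul_mul_assoc, Matrix.trace_smul, Complex.real_smul,
    Complex.re_ofReal_mul]

/-- The quadratic form depends on `K` only through the commutator with `ρ`. -/
theorem quadForm_congr {θ ρ K L : Mat n} (hc : Commute ρ θ) (h : ⁅ρ, K⁆ = ⁅ρ, L⁆) :
    quadForm θ ρ K = quadForm θ ρ L := by
  -- The cross terms in `K = L + Z`, with `Z` commuting with `ρ`, have zero trace against `θ`; this
  -- is where `ρ` must commute with `θ`.
  have key : ∀ M Z : Mat n, Commute ρ Z →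
      ((Z * M * ρ + M * Z * ρ - 2 * (Z * ρ * M) - 2 * (M * ρ * Z) + ρ * (Z * M) + ρ * (M * Z)) *
        θ).trace = 0 := by
    intro M Z hZ
    have a1 : (Z * M * ρ * θ).trace = (θ * Z * M * ρ).trace := by
      rw [Matrix.trace_mul_comm, ← mul_assoc, ← mul_assoc]
    have a2 : (θ * Z * M * ρ).trace = (ρ * θ * Z * M).trace := by
      rw [Matrix.trace_mul_comm, ← mul_assoc, ← mul_assoc]
    have a3 : (ρ * (Z * M) * θ).trace = (ρ * θ * Z * M).trace := by
      rw [Matrix.trace_mul_comm, hc.eq]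
      simp only [mul_assoc]
    have a4 : (Z * ρ * M * θ).trace = (ρ * θ * Z * M).trace := by
      rw [Matrix.trace_mul_comm, hc.eq, ← hZ.eq]
      simp only [mul_assoc]
    have b2 : (M * ρ * Z * θ).trace = (M * Z * ρ * θ).trace := by
      rw [mul_assoc M ρ Z, hZ.eq, ← mul_assoc]
    have b3 : (ρ * (M * Z) * θ).trace = (M * Z * ρ * θ).trace := by
      rw [mul_assoc, Matrix.trace_mul_comm, mul_assoc (M * Z), ← hc.eq, ← mul_assoc]
    simp only [add_mul, sub_mul, Matrix.trace_add, Matrix.trace_sub, two_mul, a1, a2, a3, a4, b2,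
      b3]
    ring
  have hZ : Commute ρ (K - L) := by
    have h0 : ⁅ρ, K - L⁆ = 0 := by rw [lie_sub_right, h, sub_self]
    exact sub_eq_zero.1 h0
  have e : (K * K * ρ - 2 * (K * ρ * K) + ρ * (K * K)) * θ =
      (L * L * ρ - 2 * (L * ρ * L) + ρ * (L * L)) * θ +
      ((K - L) * L * ρ + L * (K - L) * ρ - 2 * ((K - L) * ρ * L) - 2 * (L * ρ * (K - L)) +
        ρ * ((K - L) * L) + ρ * (L * (K - L))) * θ +
      ((K - L) * (K - L) * ρ - 2 * ((K - L) * ρ * (K - L)) + ρ * ((K - L) * (K - L))) * θ := by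
    noncomm_ring
  have e2 : (K - L) * (K - L) * ρ - 2 * ((K - L) * ρ * (K - L)) + ρ * ((K - L) * (K - L)) = 0 := by
    rw [mul_assoc _ _ ρ, mul_assoc _ ρ, hZ.eq, ← mul_assoc ρ, hZ.eq, mul_assoc _ ρ, hZ.eq]
    noncomm_ring
  rw [quadForm, quadForm, e, Matrix.trace_add, Matrix.trace_add, key L _ hZ, e2]
  simp

/-- The objective as a continuous linear functional. -/
def objectiveCLM (θ : Mat n) : Mat n →L[ℝ] ℝ :=
  LinearMap.toContinuousLinearMap
    { toFun := objective θ
      map_add' := fun A B => by simp [objective, add_mul]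
      map_smul' := fun c A => by simp [objective] }

theorem hasDerivAt_objective (θ : Mat n) {γ : ℝ → Mat n} {γ' : Mat n} {s : ℝ}
    (h : HasDerivAt γ γ' s) : HasDerivAt (fun s => objective θ (γ s)) (objective θ γ') s :=
  (objectiveCLM θ).hasFDerivAt.comp_hasDerivAt s h

theorem fderiv_objective (θ ρ ξ : Mat n) : fderiv ℝ (objective θ) ρ ξ = objective θ ξ :=
  DFunLike.congr_fun (objectiveCLM θ).hasFDerivAt.fderiv ξ

theorem contDiff_objective (θ : Mat n) {k : WithTop ℕ∞} : ContDiff ℝ k (objective θ) :=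
  (objectiveCLM θ).contDiff

/-- The acceleration enters only through `tr (Y'' (ρθ - θρ))`, which vanishes. Hence all unitary
curves with the same velocity give the same second derivative. -/
theorem deriv_deriv_objective_conj {θ ρ : Mat n} (hc : Commute ρ θ) {Y Y' : ℝ → Mat n} {Y'' : Mat n}
    (h0 : Y 0 = 1) (hU : ∀ s, Y s * star (Y s) = 1) (h1 : ∀ s, HasDerivAt Y (Y' s) s)
    (h2 : HasDerivAt Y' Y'' 0) :
    star (Y' 0) = -Y' 0 ∧
      deriv (deriv fun s => objective θ (Y s * ρ * star (Y s))) 0 = quadForm θ ρ (Y' 0) := by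
  have u1 : ∀ s, Y' s * star (Y s) + Y s * star (Y' s) = 0 := fun s => by
    have h := (h1 s).mul (h1 s).star
    have e : (Y * fun s => star (Y s)) = fun _ => 1 := funext hU
    rw [e] at h
    exact h.unique (hasDerivAt_const s 1)
  have hK : star (Y' 0) = -Y' 0 := by
    have := u1 0
    rw [h0, star_one, mul_one, one_mul] at this
    exact (neg_eq_of_add_eq_zero_right this).symm
  -- Unitarity differentiated twice at `0`.
  have u2 : star Y'' = 2 * (Y' 0 * Y' 0) - Y'' := by
    have h := (h2.mul (h1 0).star).add ((h1 0).mul h2.star)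
    have e : ((Y' * fun s => star (Y s)) + (Y * fun s => star (Y' s))) = fun _ => 0 := funext u1
    rw [e] at h
    have h' := h.unique (hasDerivAt_const 0 0)
    rw [h0, star_one, hK] at h'
    have e2 : star Y'' = Y'' * 1 + Y' 0 * -Y' 0 + (Y' 0 * -Y' 0 + 1 * star Y'') +
      (2 * (Y' 0 * Y' 0) - Y'') := by noncomm_ring
    rw [e2, h', zero_add]
  refine ⟨hK, ?_⟩
  have d1 : deriv (fun s => objective θ (Y s * ρ * star (Y s))) =
      fun s => objective θ (Y' s * ρ * star (Y s) + Y s * ρ * star (Y' s)) :=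
    funext fun s => (hasDerivAt_objective θ (((h1 s).mul_const ρ).mul (h1 s).star)).deriv
  have d2 := hasDerivAt_objective θ
    (((h2.mul_const ρ).mul (h1 0).star).add (((h1 0).mul_const ρ).mul h2.star))
  rw [d1]
  refine d2.deriv.trans ?_
  rw [h0, star_one, hK, u2]
  have e3 : (Y'' * ρ * 1 + Y' 0 * ρ * -Y' 0 + (Y' 0 * ρ * -Y' 0 +
      1 * ρ * (2 * (Y' 0 * Y' 0) - Y''))) * θ =
      (Y' 0 * Y' 0 * ρ - 2 * (Y' 0 * ρ * Y' 0) + ρ * (Y' 0 * Y' 0)) * θ +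
      (Y'' * (ρ * θ) - ρ * (Y'' * θ)) + (ρ * (Y' 0 * Y' 0) * θ - (Y' 0 * Y' 0) * (ρ * θ)) := by
    noncomm_ring
  have t1 : ∀ A : Mat n, (ρ * (A * θ)).trace = (A * (ρ * θ)).trace := fun A => by
    rw [Matrix.trace_mul_comm, hc.eq, mul_assoc]
  rw [objective, e3, Matrix.trace_add, Matrix.trace_add, Matrix.trace_sub, Matrix.trace_sub,
    mul_assoc ρ (Y' 0 * Y' 0) θ, t1, t1]
  simp [quadForm]

theorem deriv_deriv_objective_exp {θ ρ Ω : Mat n} (hc : Commute ρ θ) (hs : star Ω = -Ω) :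
    deriv (deriv fun t : ℝ => objective θ
      (NormedSpace.exp (-t • Ω) * ρ * NormedSpace.exp (t • Ω))) 0 = quadForm θ ρ Ω := by
  have hstar : ∀ s : ℝ, star (NormedSpace.exp (-s • Ω)) = NormedSpace.exp (s • Ω) := fun s => by
    rw [NormedSpace.star_exp, star_smul, hs, star_trivial, neg_smul, smul_neg, neg_neg]
  have h1 : ∀ s : ℝ, HasDerivAt (fun s : ℝ => NormedSpace.exp (-s • Ω))
      (NormedSpace.exp (-s • Ω) * -Ω) s := fun s => by
    have h := hasDerivAt_exp_smul_const (𝕂 := ℝ) (-Ω) s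
    simp only [smul_neg, ← neg_smul] at h
    exact h
  have e0 : NormedSpace.exp (-(0 : ℝ) • Ω) = 1 := by rw [neg_zero, zero_smul, NormedSpace.exp_zero]
  have h := (deriv_deriv_objective_conj hc (Y := fun s : ℝ => NormedSpace.exp (-s • Ω)) e0
    (fun s => by
      rw [hstar, ← Matrix.exp_add_of_commute, neg_smul, neg_add_cancel, NormedSpace.exp_zero]
      exact ((Commute.refl Ω).smul_left _).smul_right s) h1
    ((h1 0).mul_const (-Ω))).2
  rw [e0, one_mul, quadForm_neg] at h
  simp only [hstar] at h
  exact h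

theorem hessQuad_eq {θ ρ : Mat n} (hc : Commute ρ θ) {ξ : Mat n} (hξ : ξ ∈ tangentSpace ρ) :
    hessQuad θ ρ ξ = quadForm θ ρ (lift ρ ξ) := by
  rw [hessQuad, iteratedDeriv_succ, iteratedDeriv_one]
  exact deriv_deriv_objective_exp hc (lift_spec hξ).1.1.1

/-- Any skew-Hermitian representative computes the Hessian, horizontal or not. -/
theorem hessQuad_eq_of_lie {θ ρ : Mat n} (hc : Commute ρ θ) {K : Mat n} (hK : star K = -K) :
    hessQuad θ ρ ⁅ρ, K⁆ = quadForm θ ρ K := by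
  have hξ := lie_mem_tangentSpace ρ hK
  rw [hessQuad_eq hc hξ]
  exact quadForm_congr hc (lift_spec hξ).2

/-- At a point commuting with `θ` the polarized form is the quadratic form on the diagonal. -/
theorem hessForm_self {θ ρ : Mat n} (hc : Commute ρ θ) {ξ : Mat n} (hξ : ξ ∈ tangentSpace ρ) :
    hessForm θ ρ ξ ξ = hessQuad θ ρ ξ := by
  have h : hessQuad θ ρ (ξ + ξ) = 4 * hessQuad θ ρ ξ := by
    rw [← two_smul ℝ, hessQuad_eq hc hξ, hessQuad_eq hc ((tangentSpace ρ).smul_mem 2 hξ),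
      lift_smul 2 hξ, quadForm_smul]
    norm_num
  rw [hessForm, h]
  ring

/-! ### Second variation of the cost along lines of controls -/

section control

variable {T : ℝ} {H₀ H₁ ρ₀ θ : Mat n}

theorem endMap_eq_conj (hT : 0 ≤ T) (hH₀ : H₀ ∈ su n) (hH₁ : H₁ ∈ su n) (u : Control T) :
    endMap H₀ H₁ ρ₀ u = propagator hT H₀ H₁ u * ρ₀ * star (propagator hT H₀ H₁ u) := by
  obtain ⟨h1, h2⟩ := propagator_spec hT hH₀ hH₁ ρ₀ u
  have h3 := mul_eq_one_comm.1 h1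
  set X := propagator hT H₀ H₁ u
  calc endMap H₀ H₁ ρ₀ u = (X * star X) * endMap H₀ H₁ ρ₀ u * (X * star X) := by simp [h3]
    _ = X * (star X * endMap H₀ H₁ ρ₀ u * X) * star X := by noncomm_ring
    _ = _ := by rw [h2]

theorem hasDerivAt_line {E : Type*} [NormedAddCommGroup E] [NormedSpace ℝ E] {f : Control T → E}
    (hf : Differentiable ℝ f) (u v : Control T) (s : ℝ) :
    HasDerivAt (fun s : ℝ => f (u + s • v)) (fderiv ℝ f (u + s • v) v) s := by
  have h : HasDerivAt (fun s : ℝ => u + s • v) v s := by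
    simpa using ((hasDerivAt_id s).smul_const v).const_add u
  exact (hf _).hasFDerivAt.comp_hasDerivAt s h

theorem contDiff_cost (hT : 0 ≤ T) {k : WithTop ℕ∞} :
    ContDiff ℝ k (cost (T := T) H₀ H₁ ρ₀ θ) :=
  (contDiff_objective θ).comp (contDiff_endMap hT H₀ H₁ ρ₀)

/-- Along a line of controls, the end point moves by conjugation with unitaries. -/
theorem dEnd_eq_lie (hT : 0 ≤ T) (hH₀ : H₀ ∈ su n) (hH₁ : H₁ ∈ su n) (u v : Control T) :
    ∃ K : Mat n, star K = -K ∧ dEnd H₀ H₁ ρ₀ u v = ⁅endMap H₀ H₁ ρ₀ u, K⁆ ∧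
      ∀ θ, Commute (endMap H₀ H₁ ρ₀ u) θ →
        fderiv ℝ (fderiv ℝ (cost (T := T) H₀ H₁ ρ₀ θ)) u v v =
          quadForm θ (endMap H₀ H₁ ρ₀ u) K := by
  set X := propagator hT H₀ H₁ with hXdef
  set ρ := endMap H₀ H₁ ρ₀ u with hρ
  have hX : ContDiff ℝ 2 X := contDiff_propagator hT H₀ H₁
  have hXd : Differentiable ℝ X := hX.differentiable (by norm_num)
  have hXd2 : Differentiable ℝ (fderiv ℝ X) :=
    (hX.fderiv_right (m := 1) (by norm_num)).differentiable (by norm_num)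
  have hU : ∀ w, star (X w) * X w = 1 := fun w => (propagator_spec hT hH₀ hH₁ ρ₀ w).1
  have hU' : ∀ w, X w * star (X w) = 1 := fun w => mul_eq_one_comm.1 (hU w)
  have hρ0 : star (X u) * ρ * X u = ρ₀ := (propagator_spec hT hH₀ hH₁ ρ₀ u).2
  -- The propagator relative to that of `u`, so that the curve starts at `1` and acts on the end
  -- point of `u`.
  let Y : ℝ → Mat n := fun s => X (u + s • v) * star (X u)
  let Y' : ℝ → Mat n := fun s => fderiv ℝ X (u + s • v) v * star (X u)
  have hY0 : Y 0 = 1 := by simp [Y, hU']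
  have hYU : ∀ s, Y s * star (Y s) = 1 := fun s => by
    simp only [Y, star_mul, star_star]
    rw [mul_assoc, ← mul_assoc (star (X u)), hU, one_mul, hU']
  have h1 : ∀ s, HasDerivAt Y (Y' s) s := fun s => (hasDerivAt_line hXd u v s).mul_const _
  have h2 : HasDerivAt Y' (fderiv ℝ (fderiv ℝ X) (u + (0 : ℝ) • v) v v * star (X u)) 0 :=
    (((ContinuousLinearMap.apply ℝ (Mat n) v).hasFDerivAt.comp_hasDerivAt (0 : ℝ)
      (hasDerivAt_line hXd2 u v 0))).mul_const _
  have hend : ∀ s : ℝ, endMap H₀ H₁ ρ₀ (u + s • v) = Y s * ρ * star (Y s) := fun s => by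
    rw [endMap_eq_conj hT hH₀ hH₁, ← hρ0]
    simp only [Y, star_mul, star_star, mul_assoc]
    rfl
  -- Only the skewness of the velocity is wanted here, so the observable is taken to be `1`.
  have hK := (deriv_deriv_objective_conj (Commute.one_right ρ) hY0 hYU h1 h2).1
  refine ⟨-Y' 0, by rw [star_neg, hK], ?_, fun θ hc => ?_⟩
  · have hEd : Differentiable ℝ (endMap H₀ H₁ ρ₀ : Control T → Mat n) :=
      (contDiff_endMap (k := 1) hT H₀ H₁ ρ₀).differentiable (by norm_num)
    have d1 := hasDerivAt_line hEd u v 0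
    simp only [hend, zero_smul, add_zero] at d1
    have d2 := d1.unique (((h1 0).mul_const ρ).mul (h1 0).star)
    rw [dEnd, d2, hY0, star_one, hK, Ring.lie_def]
    noncomm_ring
  · have hcost : ContDiff ℝ 2 (cost (T := T) H₀ H₁ ρ₀ θ) := contDiff_cost hT
    have hcd : Differentiable ℝ (cost (T := T) H₀ H₁ ρ₀ θ) := hcost.differentiable (by norm_num)
    have hcd2 : Differentiable ℝ (fderiv ℝ (cost (T := T) H₀ H₁ ρ₀ θ)) :=
      (hcost.fderiv_right (m := 1) (by norm_num)).differentiable (by norm_num)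
    have e1 : deriv (fun s : ℝ => cost (T := T) H₀ H₁ ρ₀ θ (u + s • v)) =
        fun s => fderiv ℝ (cost (T := T) H₀ H₁ ρ₀ θ) (u + s • v) v :=
      funext fun s => (hasDerivAt_line hcd u v s).deriv
    have e2 := ((ContinuousLinearMap.apply ℝ ℝ v).hasFDerivAt.comp_hasDerivAt (0 : ℝ)
      (hasDerivAt_line hcd2 u v 0)).deriv
    have h := (deriv_deriv_objective_conj hc hY0 hYU h1 h2).2
    simp only [← hend] at h
    change deriv (deriv fun s : ℝ => cost (T := T) H₀ H₁ ρ₀ θ (u + s • v)) 0 = _ at h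
    rw [e1] at h
    rw [quadForm_neg, ← h]
    refine Eq.trans ?_ e2.symm
    simp

end control

end QControl

end

/-! ### The Hessian of the cost as an operator -/

noncomputable section

namespace QControl

variable {n : ℕ} {T : ℝ} {H₀ H₁ ρ₀ θ : Mat n} {u : Control T}

theorem dEnd_mem_tangentSpace (hT : 0 ≤ T) (hH₀ : H₀ ∈ su n) (hH₁ : H₁ ∈ su n) (v : Control T) :
    dEnd H₀ H₁ ρ₀ u v ∈ tangentSpace (endMap H₀ H₁ ρ₀ u) := by
  obtain ⟨K, hK, h, -⟩ := dEnd_eq_lie (ρ₀ := ρ₀) hT hH₀ hH₁ u v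
  rw [h]
  exact lie_mem_tangentSpace _ hK

/-- The range lies in the tangent space, and the dimensions agree because the end point is a unitary
conjugate of `ρ₀`. -/
theorem range_dEnd (hT : 0 ≤ T) (hH₀ : H₀ ∈ su n) (hH₁ : H₁ ∈ su n)
    (hreg : IsRegular H₀ H₁ ρ₀ u) :
    LinearMap.range (dEnd H₀ H₁ ρ₀ u : Control T →ₗ[ℝ] Mat n) =
      tangentSpace (endMap H₀ H₁ ρ₀ u) := by
  refine Submodule.eq_of_le_of_finrank_eq ?_ ?_
  · rintro _ ⟨v, rfl⟩
    exact dEnd_mem_tangentSpace hT hH₀ hH₁ v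
  · rw [endMap_eq_conj hT hH₀ hH₁,
      finrank_tangentSpace_conj (propagator_spec hT hH₀ hH₁ ρ₀ u).1]
    exact hreg

theorem exists_dEnd_eq (hT : 0 ≤ T) (hH₀ : H₀ ∈ su n) (hH₁ : H₁ ∈ su n)
    (hreg : IsRegular H₀ H₁ ρ₀ u) {ξ : Mat n} (hξ : ξ ∈ tangentSpace (endMap H₀ H₁ ρ₀ u)) :
    ∃ v, dEnd H₀ H₁ ρ₀ u v = ξ := by
  rw [← range_dEnd hT hH₀ hH₁ hreg] at hξ
  exact hξ

/-- The differential of the end-point map with values in the tangent space. -/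
def dEndLin (hT : 0 ≤ T) (hH₀ : H₀ ∈ su n) (hH₁ : H₁ ∈ su n) (ρ₀ : Mat n) (u : Control T) :
    Control T →L[ℝ] tangentSpace (endMap H₀ H₁ ρ₀ u) :=
  (dEnd H₀ H₁ ρ₀ u).codRestrict _ (dEnd_mem_tangentSpace hT hH₀ hH₁)

theorem dEndAdj_spec (hT : 0 ≤ T) (hH₀ : H₀ ∈ su n) (hH₁ : H₁ ∈ su n) {ζ : Mat n}
    (hζ : ζ ∈ tangentSpace (endMap H₀ H₁ ρ₀ u)) (v : Control T) :
    metric (endMap H₀ H₁ ρ₀ u) ζ (dEnd H₀ H₁ ρ₀ u v) = inner ℝ (dEndAdj H₀ H₁ ρ₀ u ζ) v := by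
  let φ : Control T →L[ℝ] ℝ := (LinearMap.toContinuousLinearMap
    (metricForm (endMap H₀ H₁ ρ₀ u) ⟨ζ, hζ⟩)) ∘L dEndLin hT hH₀ hH₁ ρ₀ u
  have h : ∃ w : Control T, ∀ v : Control T,
      metric (endMap H₀ H₁ ρ₀ u) ζ (dEnd H₀ H₁ ρ₀ u v) = inner ℝ w v :=
    ⟨(InnerProductSpace.toDual ℝ (Control T)).symm φ, fun v => by
      rw [InnerProductSpace.toDual_symm_apply]
      rfl⟩
  exact Classical.epsilon_spec h v

/-- If `v = dEnd* ζ`, then `⟨v, v⟩` is the metric product of `ζ` with `dEnd v`; so the image of the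
adjoint meets the kernel trivially. -/
theorem ne_zero_of_mem_adjImage (hT : 0 ≤ T) (hH₀ : H₀ ∈ su n) (hH₁ : H₁ ∈ su n) {v : Control T}
    (hv : v ∈ adjImage H₀ H₁ ρ₀ u) (h0 : v ≠ 0) : dEnd H₀ H₁ ρ₀ u v ≠ 0 := by
  obtain ⟨ζ, hζ, rfl⟩ := hv
  intro h
  have e := dEndAdj_spec hT hH₀ hH₁ hζ (dEndAdj H₀ H₁ ρ₀ u ζ)
  rw [h] at e
  have e2 : metric (endMap H₀ H₁ ρ₀ u) ζ 0 = 0 :=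
    map_zero (metricForm (endMap H₀ H₁ ρ₀ u) ⟨ζ, hζ⟩)
  rw [e2] at e
  exact h0 (inner_self_eq_zero.1 e.symm)

/-- On the image of the adjoint, the differential at a regular control reaches every tangent
vector. -/
theorem exists_mem_adjImage (hT : 0 ≤ T) (hH₀ : H₀ ∈ su n) (hH₁ : H₁ ∈ su n)
    (hreg : IsRegular H₀ H₁ ρ₀ u) {ξ : Mat n} (hξ : ξ ∈ tangentSpace (endMap H₀ H₁ ρ₀ u)) :
    ∃ v ∈ adjImage H₀ H₁ ρ₀ u, dEnd H₀ H₁ ρ₀ u v = ξ := by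
  set ρ := endMap H₀ H₁ ρ₀ u with hρ
  -- The adjoint is chosen pointwise; its linearity is recovered from the defining identity.
  have hlin : ∀ (ζ₁ ζ₂ ζ₃ : tangentSpace ρ) (c : ℝ), ζ₃ = c • ζ₁ + ζ₂ →
      dEndAdj H₀ H₁ ρ₀ u ζ₃ = c • dEndAdj H₀ H₁ ρ₀ u ζ₁ + dEndAdj H₀ H₁ ρ₀ u ζ₂ := by
    rintro ζ₁ ζ₂ _ c rfl
    refine ext_inner_right ℝ fun v => ?_
    rw [inner_add_left, real_inner_smul_left, ← dEndAdj_spec hT hH₀ hH₁ ζ₁.2,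
      ← dEndAdj_spec hT hH₀ hH₁ ζ₂.2, ← dEndAdj_spec hT hH₀ hH₁ (c • ζ₁ + ζ₂).2]
    have h : ∀ ζ : tangentSpace ρ, metric ρ ζ (dEnd H₀ H₁ ρ₀ u v) =
      metricForm ρ ζ (dEndLin hT hH₀ hH₁ ρ₀ u v) := fun _ => rfl
    rw [h, h, h, map_add, map_smul]
    rfl
  let S : tangentSpace ρ →ₗ[ℝ] tangentSpace ρ :=
    { toFun := fun ζ => dEndLin hT hH₀ hH₁ ρ₀ u (dEndAdj H₀ H₁ ρ₀ u ζ)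
      map_add' := fun ζ₁ ζ₂ => by
        rw [hlin ζ₁ ζ₂ (ζ₁ + ζ₂) 1 (by rw [one_smul]), one_smul, map_add]
      map_smul' := fun c ζ => by
        have h0 := hlin ζ 0 (c • ζ) c (by rw [add_zero])
        have h1 := hlin 0 0 0 1 (by simp)
        rw [one_smul, left_eq_add] at h1
        rw [h0, h1, add_zero, map_smul, RingHom.id_apply] }
  have hinj : Function.Injective S := by
    refine (injective_iff_map_eq_zero S).2 fun ζ h => ?_
    by_contra hne
    have h0 : dEnd H₀ H₁ ρ₀ u (dEndAdj H₀ H₁ ρ₀ u ζ) = 0 := congrArg Subtype.val h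
    have h1 : dEndAdj H₀ H₁ ρ₀ u ζ = 0 := by
      by_contra h1
      exact ne_zero_of_mem_adjImage hT hH₀ hH₁ ⟨ζ, ζ.2, rfl⟩ h1 h0
    -- By regularity `ζ = dEnd w`, so `dEnd* ζ = 0` gives `ζ` zero length.
    obtain ⟨w, hw⟩ := exists_dEnd_eq hT hH₀ hH₁ hreg ζ.2
    have h2 := dEndAdj_spec hT hH₀ hH₁ ζ.2 w
    rw [h1, inner_zero_left, hw] at h2
    exact hne (metricForm_self_eq_zero h2)
  obtain ⟨ζ, hζ⟩ := (LinearMap.injective_iff_surjective.1 hinj) ⟨ξ, hξ⟩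
  exact ⟨_, ⟨ζ, ζ.2, rfl⟩, congrArg Subtype.val hζ⟩

theorem fderiv_fderiv_cost_self (hT : 0 ≤ T) (hH₀ : H₀ ∈ su n) (hH₁ : H₁ ∈ su n)
    (hc : Commute (endMap H₀ H₁ ρ₀ u) θ) (v : Control T) :
    fderiv ℝ (fderiv ℝ (cost (T := T) H₀ H₁ ρ₀ θ)) u v v =
      hessQuad θ (endMap H₀ H₁ ρ₀ u) (dEnd H₀ H₁ ρ₀ u v) := by
  obtain ⟨K, hK, h, h2⟩ := dEnd_eq_lie (ρ₀ := ρ₀) hT hH₀ hH₁ u v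
  rw [h2 θ hc, h, hessQuad_eq_of_lie hc hK]

/-- Both sides agree on the diagonal; symmetry of the second derivative lets polarization do the
rest. -/
theorem fderiv_fderiv_cost (hT : 0 ≤ T) (hH₀ : H₀ ∈ su n) (hH₁ : H₁ ∈ su n)
    (hc : Commute (endMap H₀ H₁ ρ₀ u) θ) (v w : Control T) :
    fderiv ℝ (fderiv ℝ (cost (T := T) H₀ H₁ ρ₀ θ)) u v w =
      hessForm θ (endMap H₀ H₁ ρ₀ u) (dEnd H₀ H₁ ρ₀ u v) (dEnd H₀ H₁ ρ₀ u w) := by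
  have hsymm : IsSymmSndFDerivAt ℝ (cost (T := T) H₀ H₁ ρ₀ θ) u :=
    (contDiff_cost (k := 2) hT).contDiffAt.isSymmSndFDerivAt (by simp)
  rw [hessForm, ← map_add, ← fderiv_fderiv_cost_self hT hH₀ hH₁ hc,
    ← fderiv_fderiv_cost_self hT hH₀ hH₁ hc, ← fderiv_fderiv_cost_self hT hH₀ hH₁ hc]
  simp only [map_add, add_apply]
  rw [hsymm.eq w v]
  ring

/-- Riesz needs `hessForm` to be linear, which its definition by polarization does not show.
Regularity writes every tangent vector as `dEnd w`, where the form is a second derivative. -/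
theorem hessOp_spec (hT : 0 ≤ T) (hH₀ : H₀ ∈ su n) (hH₁ : H₁ ∈ su n)
    (hreg : IsRegular H₀ H₁ ρ₀ u) (hc : Commute (endMap H₀ H₁ ρ₀ u) θ) (v : Control T) :
    hessOp θ (endMap H₀ H₁ ρ₀ u) (dEnd H₀ H₁ ρ₀ u v) ∈ tangentSpace (endMap H₀ H₁ ρ₀ u) ∧
      ∀ η ∈ tangentSpace (endMap H₀ H₁ ρ₀ u), metric (endMap H₀ H₁ ρ₀ u)
        (hessOp θ (endMap H₀ H₁ ρ₀ u) (dEnd H₀ H₁ ρ₀ u v)) η =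
          hessForm θ (endMap H₀ H₁ ρ₀ u) (dEnd H₀ H₁ ρ₀ u v) η := by
  set ρ := endMap H₀ H₁ ρ₀ u with hρ
  have hsurj : ∀ η : tangentSpace ρ, ∃ w, dEnd H₀ H₁ ρ₀ u w = η := fun η =>
    exists_dEnd_eq hT hH₀ hH₁ hreg η.2
  let φ : tangentSpace ρ →ₗ[ℝ] ℝ :=
    { toFun := fun η => hessForm θ ρ (dEnd H₀ H₁ ρ₀ u v) η
      map_add' := fun η₁ η₂ => by
        obtain ⟨w₁, h₁⟩ := hsurj η₁
        obtain ⟨w₂, h₂⟩ := hsurj η₂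
        rw [Submodule.coe_add, ← h₁, ← h₂, ← map_add, ← fderiv_fderiv_cost hT hH₀ hH₁ hc,
          ← fderiv_fderiv_cost hT hH₀ hH₁ hc, ← fderiv_fderiv_cost hT hH₀ hH₁ hc, map_add]
      map_smul' := fun c η => by
        obtain ⟨w, h⟩ := hsurj η
        rw [Submodule.coe_smul, ← h, ← map_smul, ← fderiv_fderiv_cost hT hH₀ hH₁ hc,
          ← fderiv_fderiv_cost hT hH₀ hH₁ hc, map_smul, RingHom.id_apply] }
  obtain ⟨ζ, hζ⟩ := exists_metricForm_eq ρ φ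
  have h : ∃ ζ : Mat n, ζ ∈ tangentSpace ρ ∧
      ∀ η ∈ tangentSpace ρ, metric ρ ζ η = hessForm θ ρ (dEnd H₀ H₁ ρ₀ u v) η :=
    ⟨ζ, ζ.2, fun η hη => hζ ⟨η, hη⟩⟩
  exact Classical.epsilon_spec h

theorem inner_hessianA (hT : 0 ≤ T) (hH₀ : H₀ ∈ su n) (hH₁ : H₁ ∈ su n)
    (hreg : IsRegular H₀ H₁ ρ₀ u) (hc : Commute (endMap H₀ H₁ ρ₀ u) θ) (v w : Control T) :
    inner ℝ (hessianA H₀ H₁ ρ₀ θ u v) w =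
      hessForm θ (endMap H₀ H₁ ρ₀ u) (dEnd H₀ H₁ ρ₀ u v) (dEnd H₀ H₁ ρ₀ u w) := by
  obtain ⟨h1, h2⟩ := hessOp_spec hT hH₀ hH₁ hreg hc v
  rw [hessianA, ← dEndAdj_spec hT hH₀ hH₁ h1, h2 _ (dEnd_mem_tangentSpace hT hH₀ hH₁ w)]

theorem inner_hessianA_self (hT : 0 ≤ T) (hH₀ : H₀ ∈ su n) (hH₁ : H₁ ∈ su n)
    (hreg : IsRegular H₀ H₁ ρ₀ u) (hc : Commute (endMap H₀ H₁ ρ₀ u) θ) (v : Control T) :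
    inner ℝ v (hessianA H₀ H₁ ρ₀ θ u v) =
      hessQuad θ (endMap H₀ H₁ ρ₀ u) (dEnd H₀ H₁ ρ₀ u v) := by
  rw [real_inner_comm, inner_hessianA hT hH₀ hH₁ hreg hc,
    hessForm_self hc (dEnd_mem_tangentSpace hT hH₀ hH₁ v)]

end QControl

end

/-! ### Critical points on the orbit -/

noncomputable section

namespace QControl

variable {n : ℕ}

/-- A phase `c` with `c ^ n * det U = 1` makes `U` special and cancels in the conjugation. -/
theorem conj_mem_orbit {U : Mat n} (hU : star U * U = 1) (ρ : Mat n) :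
    U * ρ * star U ∈ orbit ρ := by
  have hU' : U * star U = 1 := mul_eq_one_comm.1 hU
  have hdet : U.det * star U.det = 1 := by
    rw [← Matrix.det_conjTranspose, ← Matrix.det_mul, ← Matrix.star_eq_conjTranspose, hU',
      Matrix.det_one]
  obtain ⟨c, hc, hc1⟩ : ∃ c : ℂ, c ^ n * U.det = 1 ∧ c * star c = 1 := by
    rcases Nat.eq_zero_or_pos n with rfl | hn
    · exact ⟨1, by simp, by simp⟩
    · obtain ⟨c, hc⟩ := IsAlgClosed.exists_pow_nat_eq (star U.det) hn
      refine ⟨c, by rw [hc, mul_comm, hdet], ?_⟩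
      have h1 : ‖U.det‖ = 1 := by
        have := congrArg norm hdet
        rw [norm_mul, norm_star, norm_one] at this
        nlinarith [norm_nonneg U.det]
      have h2 : ‖c‖ = 1 := by
        rw [← pow_eq_one_iff_of_nonneg (norm_nonneg c) hn.ne', ← norm_pow, hc, norm_star, h1]
      rw [← starRingEnd_apply, Complex.mul_conj, Complex.normSq_eq_norm_sq, h2]
      simp
  refine ⟨c • U, ?_, ?_⟩
  · rw [Matrix.mem_specialUnitaryGroup_iff, Matrix.mem_unitaryGroup_iff]
    refine ⟨?_, ?_⟩
    · rw [star_smul, smul_mul_smul_comm, hU', hc1, one_smul]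
    · rw [Matrix.det_smul, Fintype.card_fin, hc]
  · rw [Matrix.conjTranspose_smul, smul_mul_assoc, smul_mul_assoc, mul_smul_comm, smul_smul, hc1,
      one_smul, Matrix.star_eq_conjTranspose]

theorem isHermitian_of_mem_orbit {ρ₀ ρ : Mat n} (hρ₀ : ρ₀.IsHermitian) (h : ρ ∈ orbit ρ₀) :
    ρ.IsHermitian := by
  obtain ⟨U, -, rfl⟩ := h
  rw [Matrix.IsHermitian, Matrix.conjTranspose_mul, Matrix.conjTranspose_mul,
    Matrix.conjTranspose_conjTranspose, hρ₀.eq, mul_assoc]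

/-- The derivative in the direction `⁅ρ, Ω⁆` is `Re tr (Ω (θρ - ρθ))`. The matrix `θρ - ρθ` is
itself in `su n`; testing with it forces its norm to vanish. -/
theorem mem_criticalPoints_iff {ρ₀ θ ρ : Mat n} (hρ₀ : ρ₀.IsHermitian) (hθ : θ.IsHermitian) :
    ρ ∈ criticalPoints ρ₀ θ ↔ ρ ∈ orbit ρ₀ ∧ Commute ρ θ := by
  refine and_congr_right fun ho => ?_
  have hρ := isHermitian_of_mem_orbit hρ₀ ho
  have key : ∀ Ω : Mat n, objective θ ⁅ρ, Ω⁆ = (Ω * (θ * ρ - ρ * θ)).trace.re := fun Ω => by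
    rw [objective, Ring.lie_def, sub_mul, mul_sub, Matrix.trace_sub, Matrix.trace_sub,
      mul_assoc ρ, Matrix.trace_mul_comm ρ, mul_assoc, mul_assoc]
  constructor
  · intro h
    have hC : (θ * ρ - ρ * θ)ᴴ = -(θ * ρ - ρ * θ) := by
      rw [Matrix.conjTranspose_sub, Matrix.conjTranspose_mul, Matrix.conjTranspose_mul, hρ.eq,
        hθ.eq, neg_sub]
    have hsu : θ * ρ - ρ * θ ∈ su n :=
      ⟨hC, by rw [Matrix.trace_sub, Matrix.trace_mul_comm, sub_self]⟩
    have h1 := h _ (mem_tangentSpace.2 ⟨_, hsu, rfl⟩)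
    rw [fderiv_objective, key] at h1
    have h2 : hsForm n (θ * ρ - ρ * θ) (θ * ρ - ρ * θ) = 0 := by
      rw [hsForm_apply, hC, neg_mul, Matrix.trace_neg, Complex.neg_re, h1, neg_zero]
    exact (sub_eq_zero.1 (hsForm_self_eq_zero h2)).symm
  · intro hc ξ hξ
    obtain ⟨Ω, -, rfl⟩ := mem_tangentSpace.1 hξ
    rw [fderiv_objective, key, hc.eq, sub_self, mul_zero, Matrix.trace_zero, Complex.zero_re]

/-- A real diagonal matrix. -/
def diag (a : Fin n → ℝ) : Mat n := Matrix.diagonal fun i => (a i : ℂ)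

/-- The state with populations `a` in the orthonormal basis given by the columns of `V`. -/
def diagState (V : Mat n) (a : Fin n → ℝ) : Mat n := V * diag a * star V

theorem exists_eq_diagState {A : Mat n} (hA : A.IsHermitian) :
    ∃ V : Mat n, star V * V = 1 ∧ A = diagState V hA.eigenvalues := by
  refine ⟨hA.eigenvectorUnitary, Unitary.coe_star_mul_self _, ?_⟩
  conv_lhs => rw [hA.spectral_theorem, Unitary.conjStarAlgAut_apply]
  rfl

theorem star_conj_diagState {V : Mat n} (hV : star V * V = 1) (a : Fin n → ℝ) :
    star V * diagState V a * V = diag a := by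
  rw [diagState, mul_assoc, mul_assoc, mul_assoc, hV, mul_one, ← mul_assoc, hV, one_mul]

theorem diagState_injective {V : Mat n} (hV : star V * V = 1) :
    Function.Injective (diagState V) := fun a b h => by
  have h1 : diag a = diag b := by rw [← star_conj_diagState hV, h, star_conj_diagState hV]
  funext i
  exact_mod_cast congrFun (Matrix.diagonal_injective h1) i

theorem diag_mul (a : Fin n → ℝ) (A : Mat n) (i j : Fin n) : (diag a * A) i j = a i * A i j :=
  Matrix.diagonal_mul _ _ _ _

theorem mul_diag (a : Fin n → ℝ) (A : Mat n) (i j : Fin n) : (A * diag a) i j = A i j * a j :=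
  Matrix.mul_diagonal _ _ _ _

theorem diagState_commute {V : Mat n} (hV : star V * V = 1) (a b : Fin n → ℝ) :
    Commute (diagState V a) (diagState V b) := by
  have h : ∀ a b : Fin n → ℝ, diagState V a * diagState V b = V * (diag a * diag b) * star V :=
    fun a b => by
      simp only [diagState, mul_assoc]
      rw [← mul_assoc (star V) V, hV, one_mul]
  have h2 : diag a * diag b = diag b * diag a := Matrix.commute_diagonal _ _
  rw [Commute, SemiconjBy, h, h, h2]

theorem diagState_comp_perm_mem_orbit {V W : Mat n} (hV : star V * V = 1) (hW : star W * W = 1)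
    (a : Fin n → ℝ) (σ : Equiv.Perm (Fin n)) :
    diagState V (a ∘ σ) ∈ orbit (diagState W a) := by
  let P : Mat n := (1 : Mat n).submatrix σ id
  have hP : star P = (1 : Mat n).submatrix id σ := by
    rw [Matrix.star_eq_conjTranspose, Matrix.conjTranspose_submatrix, Matrix.conjTranspose_one]
  have hPP : P * star P = 1 := by
    rw [hP]
    ext i j
    simp [P, Matrix.mul_apply, Matrix.one_apply]
  have hPa : P * diag a * star P = diag (a ∘ σ) := by
    rw [hP]
    ext i j
    rw [Matrix.mul_apply]
    simp only [mul_diag]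
    simp only [P, diag, Matrix.submatrix_apply, Matrix.one_apply, Matrix.diagonal_apply, id]
    rcases eq_or_ne i j with rfl | hij
    · simp
    · simp [hij]
  have hU : star (V * P * star W) * (V * P * star W) = 1 := by
    rw [mul_eq_one_comm, star_mul, star_mul, star_star]
    calc V * P * star W * (W * (star P * star V))
        = V * (P * ((star W * W) * star P)) * star V := by noncomm_ring
      _ = 1 := by rw [hW, one_mul, hPP, mul_one, mul_eq_one_comm.1 hV]
  have h := conj_mem_orbit hU (diagState W a)
  have e : V * P * star W * diagState W a * star (V * P * star W) = diagState V (a ∘ σ) := by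
    rw [star_mul, star_mul, star_star, diagState, diagState, ← hPa]
    calc V * P * star W * (W * diag a * star W) * (W * (star P * star V))
        = V * (P * ((star W * W) * diag a * ((star W * W) * star P))) * star V := by noncomm_ring
      _ = _ := by rw [hW, one_mul, one_mul]; noncomm_ring
  rwa [e] at h

/-- Equal characteristic polynomials have equal root multisets, and distinct entries turn this into
a bijection of indices. -/
theorem exists_perm_of_charpoly_eq {d : Fin n → ℂ} {a : Fin n → ℝ} (ha : Function.Injective a)
    (h : (Matrix.diagonal d).charpoly = (diag a).charpoly) :
    ∃ σ : Equiv.Perm (Fin n), ∀ i, d i = a (σ i) := by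
  have hr : ∀ e : Fin n → ℂ, (Matrix.diagonal e).charpoly.roots = Finset.univ.val.map e := by
    intro e
    rw [Matrix.charpoly_diagonal, Polynomial.roots_prod]
    · simp
    · simp [Finset.prod_ne_zero_iff, Polynomial.X_sub_C_ne_zero]
  have hm : Finset.univ.val.map d = Finset.univ.val.map fun i => (a i : ℂ) := by
    rw [← hr, h, diag, hr]
  have hd : Function.Injective d := by
    have hnd : (Finset.univ.val.map d).Nodup := by
      rw [hm]
      exact Finset.univ.nodup.map fun i j hij => ha (by exact_mod_cast hij)
    intro i j hij
    exact Multiset.inj_on_of_nodup_map hnd i (Finset.mem_univ i) j (Finset.mem_univ j) hij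
  have hex : ∀ i, ∃ j, (a j : ℂ) = d i := fun i => by
    have hi : d i ∈ Finset.univ.val.map d := Multiset.mem_map_of_mem d (Finset.mem_univ i)
    rw [hm] at hi
    obtain ⟨j, -, hj⟩ := Multiset.mem_map.1 hi
    exact ⟨j, hj⟩
  choose σ hσ using hex
  have hinj : Function.Injective σ := fun i j hij => hd (by rw [← hσ, ← hσ, hij])
  exact ⟨Equiv.ofBijective σ (Finite.injective_iff_bijective.1 hinj), fun i => (hσ i).symm⟩

theorem charpoly_conj {U : Mat n} (hU : star U * U = 1) (A : Mat n) :
    (U * A * star U).charpoly = A.charpoly := by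
  rw [Matrix.charpoly_mul_comm, ← mul_assoc, hU, one_mul]

/-- Commuting with a diagonal matrix of distinct entries forces a diagonal matrix; conjugation
preserves its spectrum. -/
theorem exists_perm_of_commute {V W ρ : Mat n} (hV : star V * V = 1) (hW : star W * W = 1)
    {a b : Fin n → ℝ} (ha : Function.Injective a) (hb : Function.Injective b)
    (ho : ρ ∈ orbit (diagState W a)) (hc : Commute ρ (diagState V b)) :
    ∃ σ : Equiv.Perm (Fin n), ρ = diagState V (a ∘ σ) := by
  have hV' := mul_eq_one_comm.1 hV
  set M := star V * ρ * V with hM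
  have hρ : ρ = V * M * star V := by
    calc ρ = (V * star V) * ρ * (V * star V) := by rw [hV', one_mul, mul_one]
      _ = _ := by rw [hM]; noncomm_ring
  have hcM : M * diag b = diag b * M := by
    rw [← star_conj_diagState hV b, hM]
    calc star V * ρ * V * (star V * diagState V b * V)
        = star V * (ρ * (V * star V) * diagState V b) * V := by noncomm_ring
      _ = star V * (diagState V b * (V * star V) * ρ) * V := by
        rw [hV', mul_one, mul_one, hc.eq]
      _ = _ := by noncomm_ring
  have hMd : M = Matrix.diagonal fun i => M i i := by
    ext i j
    rcases eq_or_ne i j with rfl | hij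
    · simp
    · rw [Matrix.diagonal_apply_ne _ hij]
      have h := congrFun (congrFun hcM i) j
      rw [mul_diag, diag_mul, mul_comm, ← sub_eq_zero, ← sub_mul, mul_eq_zero] at h
      refine h.resolve_left fun h0 => hij (hb ?_).symm
      exact_mod_cast sub_eq_zero.1 h0
  have hchar : (Matrix.diagonal fun i => M i i).charpoly = (diag a).charpoly := by
    obtain ⟨U, hU, hU2⟩ := ho
    have hU1 : star U * U = 1 :=
      Matrix.mem_unitaryGroup_iff'.1 (Matrix.mem_specialUnitaryGroup_iff.1 hU).1
    rw [← hMd, ← charpoly_conj hV, ← hρ, hU2, ← Matrix.star_eq_conjTranspose, charpoly_conj hU1,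
      diagState, charpoly_conj hW]
  obtain ⟨σ, hσ⟩ := exists_perm_of_charpoly_eq ha hchar
  refine ⟨σ, ?_⟩
  rw [hρ, hMd]
  simp only [hσ]
  rfl

/-- The critical points are the states whose populations in the eigenbasis of the observable are
the permuted eigenvalues. -/
theorem criticalPoints_eq_range {V W : Mat n} (hV : star V * V = 1) (hW : star W * W = 1)
    {a b : Fin n → ℝ} (ha : Function.Injective a) (hb : Function.Injective b)
    (hρ₀ : (diagState W a).IsHermitian) (hθ : (diagState V b).IsHermitian) :
    criticalPoints (diagState W a) (diagState V b) =
      Set.range fun σ : Equiv.Perm (Fin n) => diagState V (a ∘ σ) := by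
  ext ρ
  rw [mem_criticalPoints_iff hρ₀ hθ]
  constructor
  · rintro ⟨ho, hc⟩
    obtain ⟨σ, h⟩ := exists_perm_of_commute hV hW ha hb ho hc
    exact ⟨σ, h.symm⟩
  · rintro ⟨σ, rfl⟩
    exact ⟨diagState_comp_perm_mem_orbit hV hW a σ, diagState_commute hV _ _⟩

theorem ncard_range_diagState {V : Mat n} (hV : star V * V = 1) {a : Fin n → ℝ}
    (ha : Function.Injective a) :
    (Set.range fun σ : Equiv.Perm (Fin n) => diagState V (a ∘ σ)).ncard = n.factorial := by
  have hinj : Function.Injective fun σ : Equiv.Perm (Fin n) => diagState V (a ∘ σ) :=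
    fun σ τ h => Equiv.ext fun i => ha (congrFun (diagState_injective hV h) i)
  rw [← Set.image_univ, Set.ncard_image_of_injective _ hinj, Set.ncard_univ, Nat.card_perm,
    Nat.card_fin]

theorem objective_diagState {V : Mat n} (hV : star V * V = 1) (a b : Fin n → ℝ) :
    objective (diagState V b) (diagState V a) = ∑ i, a i * b i := by
  have h : diagState V a * diagState V b = V * (diag a * diag b * star V) := by
    simp only [diagState, mul_assoc]
    rw [← mul_assoc (star V) V, hV, one_mul]
  rw [objective, h, Matrix.trace_mul_comm, mul_assoc, hV, mul_one, diag, diag,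
    Matrix.diagonal_mul_diagonal, Matrix.trace_diagonal]
  simp

/-! ### The quadratic form in the eigenbasis -/

theorem quadForm_conj {V : Mat n} (hV : star V * V = 1) (a b : Fin n → ℝ) (K : Mat n) :
    quadForm (diagState V b) (diagState V a) K = quadForm (diag b) (diag a) (star V * K * V) := by
  have hV' := mul_eq_one_comm.1 hV
  rw [quadForm, quadForm, ← star_conj_diagState hV b, ← star_conj_diagState hV a]
  set ρ := diagState V a
  set θ := diagState V b
  have hm : ∀ A B : Mat n, star V * A * V * (star V * B * V) = star V * (A * B) * V := fun A B => by
    calc _ = star V * (A * (V * star V) * B) * V := by noncomm_ring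
      _ = _ := by rw [hV', mul_one]
  have h2 : ∀ A : Mat n, 2 * (star V * A * V) = star V * (2 * A) * V := fun A => by noncomm_ring
  have ha : ∀ A B : Mat n, star V * A * V + star V * B * V = star V * (A + B) * V :=
    fun A B => by noncomm_ring
  have hs : ∀ A B : Mat n, star V * A * V - star V * B * V = star V * (A - B) * V :=
    fun A B => by noncomm_ring
  rw [hm, hm, hm, hm, hm, h2, hs, ha, hm, Matrix.trace_mul_comm (star V * _), ← mul_assoc V, hV',
    one_mul]

/-- The trace gives `2 b i (a i - a j) |L i j|²`, summed with a minus sign. As `|L i j|` is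
symmetric, averaging with `i` and `j` exchanged yields the product of differences. -/
theorem quadForm_diag (a b : Fin n → ℝ) {L : Mat n} (hL : star L = -L) :
    quadForm (diag b) (diag a) L =
      -∑ i, ∑ j, (a i - a j) * (b i - b j) * Complex.normSq (L i j) := by
  have hsymm : ∀ i j, L j i = -star (L i j) := fun i j => by
    have := congrFun (congrFun hL j) i
    rw [Matrix.star_apply, Matrix.neg_apply] at this
    rw [this, neg_neg]
  have hprod : ∀ i j, L i j * L j i = -(Complex.normSq (L i j) : ℂ) := fun i j => by
    rw [hsymm i j, mul_neg, ← starRingEnd_apply, Complex.mul_conj]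
  have hns : ∀ i j, Complex.normSq (L j i) = Complex.normSq (L i j) := fun i j => by
    rw [hsymm i j, Complex.normSq_neg, ← starRingEnd_apply, Complex.normSq_conj]
  have h1 : quadForm (diag b) (diag a) L =
      -∑ i, ∑ j, 2 * b i * (a i - a j) * Complex.normSq (L i j) := by
    have hentry : ∀ i, ((L * L * diag a - 2 * (L * diag a * L) + diag a * (L * L)) * diag b) i i =
        ((-∑ j, 2 * b i * (a i - a j) * Complex.normSq (L i j) : ℝ) : ℂ) := fun i => by
      rw [mul_diag, Matrix.add_apply, Matrix.sub_apply, mul_diag, diag_mul, two_mul,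
        Matrix.add_apply, Matrix.mul_apply, Matrix.mul_apply]
      simp only [mul_diag]
      push_cast
      rw [Finset.sum_mul, Finset.mul_sum, ← Finset.sum_add_distrib, ← Finset.sum_sub_distrib,
        ← Finset.sum_add_distrib, Finset.sum_mul, ← Finset.sum_neg_distrib]
      refine Finset.sum_congr rfl fun j _ => ?_
      linear_combination (2 * (b i : ℂ) * (a i - a j)) * hprod i j
    rw [quadForm, Matrix.trace]
    simp only [Matrix.diag_apply, hentry]
    rw [← Complex.ofReal_sum, Complex.ofReal_re, Finset.sum_neg_distrib]
  have h2 : ∑ i, ∑ j, 2 * b i * (a i - a j) * Complex.normSq (L i j) =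
      ∑ i, ∑ j, 2 * b j * (a j - a i) * Complex.normSq (L i j) := by
    rw [Finset.sum_comm]
    refine Finset.sum_congr rfl fun i _ => Finset.sum_congr rfl fun j _ => ?_
    rw [hns]
  have h3 : 2 * ∑ i, ∑ j, (a i - a j) * (b i - b j) * Complex.normSq (L i j) =
      ∑ i, ∑ j, 2 * b i * (a i - a j) * Complex.normSq (L i j) +
      ∑ i, ∑ j, 2 * b j * (a j - a i) * Complex.normSq (L i j) := by
    rw [← Finset.sum_add_distrib, Finset.mul_sum]
    refine Finset.sum_congr rfl fun i _ => ?_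
    rw [← Finset.sum_add_distrib, Finset.mul_sum]
    refine Finset.sum_congr rfl fun j _ => ?_
    ring
  rw [h1, neg_inj]
  linarith

/-- `a` and `b` are oppositely ordered. -/
def StrictAntivary (a b : Fin n → ℝ) : Prop := ∀ i j, i ≠ j → (a i - a j) * (b i - b j) < 0

theorem quadForm_neg_right (a b : Fin n → ℝ) (L : Mat n) :
    quadForm (diag (-b)) (diag a) L = -quadForm (diag b) (diag a) L := by
  have h : diag (-b) = -diag b := by
    ext i j
    simp [diag, Matrix.diagonal_apply]
    split_ifs <;> simp
  simp [quadForm, h]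

/-- The quadratic form of an oppositely ordered state is positive off the stabilizer. -/
theorem quadForm_pos {V : Mat n} (hV : star V * V = 1) {a b : Fin n → ℝ} (h : StrictAntivary a b)
    {K : Mat n} (hK : star K = -K) (hne : ⁅diagState V a, K⁆ ≠ 0) :
    0 < quadForm (diag b) (diag a) (star V * K * V) := by
  set L := star V * K * V with hL
  have hLs : star L = -L := by
    rw [hL, star_mul, star_mul, star_star, hK]
    noncomm_ring
  -- Otherwise `L` is diagonal, and `K` commutes with the state.
  obtain ⟨i, j, hij, hLij⟩ : ∃ i j, i ≠ j ∧ L i j ≠ 0 := by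
    by_contra! h0
    refine hne ?_
    have hV' := mul_eq_one_comm.1 hV
    have hLc : diag a * L = L * diag a := by
      ext i j
      rw [diag_mul, mul_diag]
      rcases eq_or_ne i j with rfl | hij
      · rw [mul_comm]
      · rw [h0 i j hij, mul_zero, zero_mul]
    have hKL : K = V * L * star V := by
      calc K = (V * star V) * K * (V * star V) := by rw [hV', one_mul, mul_one]
        _ = _ := by rw [hL]; noncomm_ring
    rw [Ring.lie_def, hKL, diagState]
    calc V * diag a * star V * (V * L * star V) - V * L * star V * (V * diag a * star V)
        = V * (diag a * (star V * V) * L - L * (star V * V) * diag a) * star V := by noncomm_ring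
      _ = 0 := by rw [hV, mul_one, mul_one, hLc]; simp
  rw [quadForm_diag a b hLs, ← Finset.sum_neg_distrib]
  have hterm : ∀ k l, 0 ≤ -((a k - a l) * (b k - b l) * Complex.normSq (L k l)) := fun k l => by
    rcases eq_or_ne k l with rfl | hkl
    · simp
    · rw [← neg_mul]
      exact mul_nonneg (neg_nonneg.2 (h k l hkl).le) (Complex.normSq_nonneg _)
  refine Finset.sum_pos' (fun k _ => ?_) ⟨i, Finset.mem_univ i, ?_⟩
  · rw [← Finset.sum_neg_distrib]
    exact Finset.sum_nonneg fun l _ => hterm k l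
  · rw [← Finset.sum_neg_distrib]
    refine Finset.sum_pos' (fun l _ => hterm i l) ⟨j, Finset.mem_univ j, ?_⟩
    rw [← neg_mul]
    exact mul_pos (neg_pos.2 (h i j hij)) (Complex.normSq_pos.2 hLij)

/-- A rotation in the plane of the levels `i` and `j`. -/
theorem exists_quadForm_eq {V : Mat n} (hV : star V * V = 1) (a b : Fin n → ℝ) {i j : Fin n}
    (hij : i ≠ j) : ∃ K : Mat n, star K = -K ∧
      quadForm (diagState V b) (diagState V a) K = -(2 * ((a i - a j) * (b i - b j))) := by
  let L : Mat n := Matrix.single i j 1 - Matrix.single j i 1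
  have hL : star L = -L := by
    simp [L, Matrix.star_eq_conjTranspose]
  refine ⟨V * L * star V, ?_, ?_⟩
  · rw [star_mul, star_mul, star_star, hL]
    noncomm_ring
  · have e : star V * (V * L * star V) * V = L := by
      calc star V * (V * L * star V) * V = (star V * V) * L * (star V * V) := by noncomm_ring
        _ = L := by rw [hV, one_mul, mul_one]
    rw [quadForm_conj hV, e, quadForm_diag a b hL, neg_inj]
    -- The entries `(i, j)` and `(j, i)` contribute equally, whence the factor `2`.
    have hns : ∀ k l, Complex.normSq (L k l) =
        (if k = i ∧ l = j then 1 else 0) + if k = j ∧ l = i then 1 else 0 := fun k l => by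
      by_cases h1 : k = i ∧ l = j
      · obtain ⟨rfl, rfl⟩ := h1
        simp [L, hij, hij.symm]
      · by_cases h2 : k = j ∧ l = i
        · obtain ⟨rfl, rfl⟩ := h2
          simp [L, hij, hij.symm]
        · rw [if_neg h1, if_neg h2]
          simp only [L, Matrix.sub_apply, Matrix.single_apply]
          rw [if_neg (fun h => h1 ⟨h.1.symm, h.2.symm⟩),
            if_neg (fun h => h2 ⟨h.1.symm, h.2.symm⟩)]
          simp
    simp only [hns, mul_add, Finset.sum_add_distrib, mul_ite, mul_one, mul_zero]
    simp [ite_and]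
    ring

end QControl

end

/-! ### Extremal orderings and the main theorem -/

noncomputable section

namespace QControl

variable {n : ℕ}

theorem StrictAntivary.lt_iff {a b : Fin n → ℝ} (h : StrictAntivary a b) (i j : Fin n) :
    a j < a i ↔ b i < b j := by
  rcases eq_or_ne i j with rfl | hij
  · simp
  · have h1 := h i j hij
    constructor
    · intro h2
      by_contra! h3
      nlinarith
    · intro h2
      by_contra! h3
      nlinarith

/-- Opposite ordering fixes the rank of `a (σ i)` among the values of `a`: it is the number of `j`
with `b i < b j`, whatever `σ` is. For injective `a` the rank determines the index. -/
theorem eq_of_strictAntivary {a b : Fin n → ℝ} (ha : Function.Injective a)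
    {σ τ : Equiv.Perm (Fin n)} (hσ : StrictAntivary (a ∘ σ) b) (hτ : StrictAntivary (a ∘ τ) b) :
    σ = τ := by
  let r : Fin n → ℕ := fun k => (Finset.univ.filter fun l => a l < a k).card
  have hlt : ∀ k l, a k < a l → r k < r l := fun k l h => by
    refine Finset.card_lt_card (Finset.ssubset_iff_of_subset ?_ |>.2 ⟨k, ?_, ?_⟩)
    · intro m hm
      simp only [Finset.mem_filter, Finset.mem_univ, true_and] at hm ⊢
      exact hm.trans h
    · simpa using h
    · simp
  have hr : Function.Injective r := fun k l h => by
    by_contra hne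
    rcases lt_or_gt_of_ne (ha.ne hne) with h1 | h1
    · exact (hlt _ _ h1).ne h
    · exact (hlt _ _ h1).ne h.symm
  have hcard : ∀ π : Equiv.Perm (Fin n), StrictAntivary (a ∘ π) b → ∀ i,
      r (π i) = (Finset.univ.filter fun j => b i < b j).card := fun π hπ i => by
    symm
    refine Finset.card_bij (fun j _ => π j) (fun j hj => ?_) (fun j _ k _ h => π.injective h)
      fun l hl => ⟨π.symm l, ?_, π.apply_symm_apply l⟩
    · simp only [Finset.mem_filter, Finset.mem_univ, true_and] at hj ⊢
      exact (hπ.lt_iff i j).2 hj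
    · simp only [Finset.mem_filter, Finset.mem_univ, true_and] at hl ⊢
      refine (hπ.lt_iff i _).1 ?_
      simpa using hl
  exact Equiv.ext fun i => hr (by rw [hcard σ hσ, hcard τ hτ])

theorem exists_pos_of_not_strictAntivary {a b : Fin n → ℝ} (ha : Function.Injective a)
    (hb : Function.Injective b) (h : ¬StrictAntivary a b) :
    ∃ i j, i ≠ j ∧ 0 < (a i - a j) * (b i - b j) := by
  simp only [StrictAntivary, not_forall, not_lt] at h
  obtain ⟨i, j, hij, h⟩ := h
  exact ⟨i, j, hij, h.lt_of_ne
    (mul_ne_zero (sub_ne_zero.2 (ha.ne hij)) (sub_ne_zero.2 (hb.ne hij))).symm⟩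

/-- A permutation minimizing the pairing with `b` is oppositely ordered. -/
theorem strictAntivary_of_forall_le {a b : Fin n → ℝ} (ha : Function.Injective a)
    (hb : Function.Injective b) {σ : Equiv.Perm (Fin n)}
    (h : ∀ τ : Equiv.Perm (Fin n), ∑ i, (a ∘ σ) i * b i ≤ ∑ i, (a ∘ τ) i * b i) :
    StrictAntivary (a ∘ σ) b := by
  by_contra hn
  obtain ⟨i, j, hij, hpos⟩ := exists_pos_of_not_strictAntivary (ha.comp σ.injective) hb hn
  have h1 := h (σ * Equiv.swap i j)
  -- Swapping `i` and `j` changes the sum by minus the positive product, contradicting minimality.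
  have h2 : ∑ k, ((a ∘ (σ * Equiv.swap i j)) k * b k - (a ∘ σ) k * b k) =
      ((a ∘ σ) j * b i - (a ∘ σ) i * b i) + ((a ∘ σ) i * b j - (a ∘ σ) j * b j) := by
    rw [Finset.sum_eq_add i j hij]
    · simp
    · intro k _ hk
      simp [Equiv.swap_apply_of_ne_of_ne hk.1 hk.2]
    · simp
    · simp
  rw [Finset.sum_sub_distrib] at h2
  nlinarith

theorem hessQuad_pos {V : Mat n} (hV : star V * V = 1) {a b : Fin n → ℝ}
    (h : StrictAntivary a b) {ξ : Mat n} (hξ : ξ ∈ tangentSpace (diagState V a)) (hne : ξ ≠ 0) :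
    0 < hessQuad (diagState V b) (diagState V a) ξ := by
  obtain ⟨K, hK, rfl⟩ := mem_tangentSpace.1 hξ
  rw [hessQuad_eq_of_lie (diagState_commute hV a b) hK.1, quadForm_conj hV]
  exact quadForm_pos hV h hK.1 hne

theorem hessQuad_neg {V : Mat n} (hV : star V * V = 1) {a b : Fin n → ℝ}
    (h : StrictAntivary a (-b)) {ξ : Mat n} (hξ : ξ ∈ tangentSpace (diagState V a))
    (hne : ξ ≠ 0) : hessQuad (diagState V b) (diagState V a) ξ < 0 := by
  obtain ⟨K, hK, rfl⟩ := mem_tangentSpace.1 hξ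
  rw [hessQuad_eq_of_lie (diagState_commute hV a b) hK.1, quadForm_conj hV]
  have := quadForm_pos hV h hK.1 hne
  rw [quadForm_neg_right] at this
  linarith

theorem exists_hessQuad_eq {V : Mat n} (hV : star V * V = 1) (a b : Fin n → ℝ) {i j : Fin n}
    (hij : i ≠ j) : ∃ ξ ∈ tangentSpace (diagState V a),
      hessQuad (diagState V b) (diagState V a) ξ = -(2 * ((a i - a j) * (b i - b j))) := by
  obtain ⟨K, hK, h⟩ := exists_quadForm_eq hV a b hij
  exact ⟨_, lie_mem_tangentSpace _ hK,
    (hessQuad_eq_of_lie (diagState_commute hV a b) hK).trans h⟩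

/-! ### Enumerations of the critical points by increasing value -/

section enumeration

variable {V : Mat n} (hV : star V * V = 1) {a b : Fin n → ℝ} (ha : Function.Injective a)
  (hb : Function.Injective b) {c : Fin n.factorial → Mat n}
  (hc : Set.range c = Set.range fun σ : Equiv.Perm (Fin n) => diagState V (a ∘ σ))
  {i : Fin n.factorial} {σ : Equiv.Perm (Fin n)} (hi : c i = diagState V (a ∘ σ))

include hV ha hb hc hi

theorem strictAntivary_of_min
    (hmin : ∀ k, objective (diagState V b) (c i) ≤ objective (diagState V b) (c k)) :
    StrictAntivary (a ∘ σ) b := by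
  refine strictAntivary_of_forall_le ha hb fun τ => ?_
  obtain ⟨k, hk⟩ : diagState V (a ∘ τ) ∈ Set.range c := hc ▸ ⟨τ, rfl⟩
  have h := hmin k
  rwa [hi, hk, objective_diagState hV, objective_diagState hV] at h

theorem strictAntivary_of_max
    (hmax : ∀ k, objective (diagState V b) (c k) ≤ objective (diagState V b) (c i)) :
    StrictAntivary (a ∘ σ) (-b) := by
  refine strictAntivary_of_forall_le ha (fun k l h => hb (neg_injective h)) fun τ => ?_
  obtain ⟨k, hk⟩ : diagState V (a ∘ τ) ∈ Set.range c := hc ▸ ⟨τ, rfl⟩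
  have h := hmax k
  rw [hi, hk, objective_diagState hV, objective_diagState hV] at h
  simpa using h

variable (hmono : Monotone fun k => objective (diagState V b) (c k))

include hmono

theorem strictAntivary_of_first (h0 : (i : ℕ) = 0) : StrictAntivary (a ∘ σ) b :=
  strictAntivary_of_min hV ha hb hc hi fun k =>
    hmono (show i ≤ k from Fin.le_def.2 (h0 ▸ Nat.zero_le _))

theorem strictAntivary_of_last (h1 : (i : ℕ) + 1 = n.factorial) : StrictAntivary (a ∘ σ) (-b) :=
  strictAntivary_of_max hV ha hb hc hi fun k =>
    hmono (show k ≤ i from Fin.le_def.2 (by have := k.2; omega))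

/-- The entry at index `0` is already oppositely ordered, and only one permutation is; injectivity
of `c` then excludes any other index. -/
theorem not_strictAntivary_of_pos (hinj : Function.Injective c) (h0 : 0 < (i : ℕ)) :
    ¬StrictAntivary (a ∘ σ) b := by
  intro h
  obtain ⟨τ, hτ⟩ : c ⟨0, n.factorial_pos⟩ ∈
      Set.range fun σ : Equiv.Perm (Fin n) => diagState V (a ∘ σ) := hc ▸ ⟨_, rfl⟩
  have h2 := strictAntivary_of_first hV ha hb hc hτ.symm hmono rfl
  have h3 := eq_of_strictAntivary ha h h2
  have h4 : c i = c ⟨0, n.factorial_pos⟩ := by rw [hi, h3]; exact hτ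
  rw [hinj h4] at h0
  exact lt_irrefl _ h0

theorem not_strictAntivary_neg_of_lt (hinj : Function.Injective c)
    (h1 : (i : ℕ) + 1 < n.factorial) : ¬StrictAntivary (a ∘ σ) (-b) := by
  intro h
  have hpos := n.factorial_pos
  let m : Fin n.factorial := ⟨n.factorial - 1, by omega⟩
  obtain ⟨τ, hτ⟩ : c m ∈
      Set.range fun σ : Equiv.Perm (Fin n) => diagState V (a ∘ σ) := hc ▸ ⟨_, rfl⟩
  have h2 := strictAntivary_of_last hV ha hb hc hτ.symm hmono (Nat.sub_add_cancel hpos)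
  have h3 := eq_of_strictAntivary ha h h2
  have h4 : c i = c m := by rw [hi, h3]; exact hτ
  rw [hinj h4] at h1
  exact h1.ne (Nat.sub_add_cancel hpos)

end enumeration

end QControl

end

theorem mainTheorem9 (n : ℕ) (T : ℝ) (hT : 0 < T)
    (H₀ H₁ ρ₀ θ : QControl.Mat n) (hH₀ : H₀ ∈ QControl.su n) (hH₁ : H₁ ∈ QControl.su n)
    (hρ₀ : ρ₀.IsHermitian) (hθ : θ.IsHermitian)
    (simple_ρ₀ : Function.Injective hρ₀.eigenvalues)
    (simple_θ : Function.Injective hθ.eigenvalues)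
    (regular : ∀ u : QControl.Control T, QControl.IsRegular H₀ H₁ ρ₀ u) :
    (QControl.criticalPoints ρ₀ θ).ncard = n.factorial ∧
    ∀ c : Fin n.factorial → QControl.Mat n,
      Function.Injective c → Set.range c = QControl.criticalPoints ρ₀ θ →
      Monotone (fun i => QControl.objective θ (c i)) →
      ∀ (i : Fin n.factorial) (u : QControl.Control T), QControl.endMap H₀ H₁ ρ₀ u = c i →
        (ContDiff ℝ 2 (QControl.cost (T := T) H₀ H₁ ρ₀ θ) ∧
          ∀ v w : QControl.Control T,
            fderiv ℝ (fderiv ℝ (QControl.cost (T := T) H₀ H₁ ρ₀ θ)) u v w =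
              inner ℝ (QControl.hessianA H₀ H₁ ρ₀ θ u v) w) ∧
        ((i : ℕ) = 0 → ∀ v ∈ QControl.adjImage H₀ H₁ ρ₀ u, v ≠ 0 →
          0 < inner ℝ v (QControl.hessianA H₀ H₁ ρ₀ θ u v)) ∧
        ((i : ℕ) + 1 = n.factorial → ∀ v ∈ QControl.adjImage H₀ H₁ ρ₀ u, v ≠ 0 →
          inner ℝ v (QControl.hessianA H₀ H₁ ρ₀ θ u v) < 0) ∧
        (0 < (i : ℕ) → (i : ℕ) + 1 < n.factorial →
          (∃ v ∈ QControl.adjImage H₀ H₁ ρ₀ u,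
            0 < inner ℝ v (QControl.hessianA H₀ H₁ ρ₀ θ u v)) ∧
          ∃ v ∈ QControl.adjImage H₀ H₁ ρ₀ u,
            inner ℝ v (QControl.hessianA H₀ H₁ ρ₀ θ u v) < 0) := by
  open QControl in
  obtain ⟨W, hW, eρ⟩ := exists_eq_diagState hρ₀
  obtain ⟨V, hV, eθ⟩ := exists_eq_diagState hθ
  -- The eigenvalues depend on the Hermitian proofs, hence on the matrices; they are made free
  -- variables before substituting the diagonalizations.
  generalize hρ₀.eigenvalues = a at simple_ρ₀ eρ
  generalize hθ.eigenvalues = b at simple_θ eθ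
  subst eρ eθ
  have hcrit := criticalPoints_eq_range hV hW simple_ρ₀ simple_θ hρ₀ hθ
  rw [hcrit]
  refine ⟨ncard_range_diagState hV simple_ρ₀, fun c hinj hc hmono i u hu => ?_⟩
  obtain ⟨σ, hσ⟩ : c i ∈ Set.range fun σ : Equiv.Perm (Fin n) => diagState V (a ∘ σ) :=
    hc ▸ ⟨i, rfl⟩
  have hend : endMap H₀ H₁ (diagState W a) u = diagState V (a ∘ σ) := hu.trans hσ.symm
  have hcomm : Commute (endMap H₀ H₁ (diagState W a) u) (diagState V b) :=
    hend ▸ diagState_commute hV _ _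
  have hA := inner_hessianA_self hT.le hH₀ hH₁ (regular u) hcomm
  have hD : ∀ v, dEnd H₀ H₁ (diagState W a) u v ∈ tangentSpace (diagState V (a ∘ σ)) := fun v =>
    hend ▸ dEnd_mem_tangentSpace hT.le hH₀ hH₁ v
  have hex : ∀ ξ ∈ tangentSpace (diagState V (a ∘ σ)),
      ∃ v ∈ adjImage H₀ H₁ (diagState W a) u, dEnd H₀ H₁ (diagState W a) u v = ξ := fun ξ hξ =>
    exists_mem_adjImage hT.le hH₀ hH₁ (regular u) (hend ▸ hξ)
  rw [hend] at hA
  refine ⟨⟨contDiff_cost hT.le, fun v w => ?_⟩, fun h0 v hv hne => ?_, fun h1 v hv hne => ?_,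
    fun h0 h1 => ⟨?_, ?_⟩⟩
  · rw [fderiv_fderiv_cost hT.le hH₀ hH₁ hcomm, inner_hessianA hT.le hH₀ hH₁ (regular u) hcomm]
  · rw [hA]
    exact hessQuad_pos hV (strictAntivary_of_first hV simple_ρ₀ simple_θ hc hσ.symm hmono h0)
      (hD v) (ne_zero_of_mem_adjImage hT.le hH₀ hH₁ hv hne)
  · rw [hA]
    exact hessQuad_neg hV (strictAntivary_of_last hV simple_ρ₀ simple_θ hc hσ.symm hmono h1)
      (hD v) (ne_zero_of_mem_adjImage hT.le hH₀ hH₁ hv hne)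
  -- Not being the maximum leaves a pair of levels ordered oppositely to `b`; the rotation in their
  -- plane has positive second variation. The last case uses a pair ordered like `b`.
  · have hn := not_strictAntivary_neg_of_lt hV simple_ρ₀ simple_θ hc hσ.symm hmono hinj h1
    obtain ⟨k, l, hkl, hpos⟩ := exists_pos_of_not_strictAntivary
      (simple_ρ₀.comp σ.injective) (neg_injective.comp simple_θ) hn
    obtain ⟨ξ, hξ, hq⟩ := exists_hessQuad_eq hV (a ∘ σ) b hkl
    obtain ⟨v, hv, rfl⟩ := hex ξ hξ
    refine ⟨v, hv, ?_⟩
    rw [hA, hq]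
    change 0 < ((a ∘ σ) k - (a ∘ σ) l) * (-b k - -b l) at hpos
    linarith
  · have hn := not_strictAntivary_of_pos hV simple_ρ₀ simple_θ hc hσ.symm hmono hinj h0
    obtain ⟨k, l, hkl, hpos⟩ := exists_pos_of_not_strictAntivary
      (simple_ρ₀.comp σ.injective) simple_θ hn
    obtain ⟨ξ, hξ, hq⟩ := exists_hessQuad_eq hV (a ∘ σ) b hkl
    obtain ⟨v, hv, rfl⟩ := hex ξ hξ
    refine ⟨v, hv, ?_⟩
    rw [hA, hq]
    linarith
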